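/- **Setting.** Let $d\ge 2$, let $\Omega\subset\mathbb R^d$ be a bounded Lipschitz domain, $f,g\in L^2(\Omega)$, $\boldsymbol f,\boldsymbol g\in L^2(\Omega)^d$, $c\in L^\infty(\Omega)$, and let $\boldsymbol A\in L^\infty(\Omega)^{d\times d}$ be symmetric and uniformly positive definite, such that $a(v,w):=\int_\Omega \boldsymbol A\nabla v\cdot\nabla w\,dx+\int_\Omega cvw\,dx$ is elliptic on $H^1_0(\Omega)$. Put $|||v|||:=a(v,v)^{1/2}$, $F(v):=\int_\Omega (fv-\boldsymbol f\cdot\nabla v)\,dx$, $G(v):=\int_\Omega(gv-\boldsymbol g\cdot\nabla v)\,dx$, and let $u^\star,z^\star\in H^1_0(\Omega)$ solve $a(u^\star,v)=F(v)$ and $a(v,z^\star)=G(v)$ for all $v\in H^1_0(\Omega)$. Let $p\ge1$. For a conforming triangulation $\mathcal T$ of $\Omega$ into compact simplices let $\mathcal X_{\mathcal T}$ be the space of all $v\in H^1_0(\Omega)$ that are polynomials of degree $\le p$ on each $T\in\mathcal T$, and let $u^\star_{\mathcal T},z^\star_{\mathcal T}\in\mathcal X_{\mathcal T}$ be the Galerkin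 solutions: $a(u_{\mathcal T}^\star,v)=F(v)$ and $a(v,z_{\mathcal T}^\star)=G(v)$ for all $v\in\mathcal X_{\mathcal T}$. **Meshes.** Let $\mathcal T_0$ be a conforming triangulation of $\Omega$ and $\mathtt{refine}$ a fixed deterministic refinement strategy. Let $\mathbb T(\mathcal T)$ be the set of all meshes obtained from $\mathcal T$ by finitely many steps $\mathcal S\mapsto\mathtt{refine}(\mathcal S,\mathcal M)$ with $\mathcal M\subseteq\mathcal S$, and $\mathbb T:=\mathbb T(\mathcal T_0)$. For $\mathcal T\in\mathbb T$ and $\mathcal M\subseteq\mathcal T$, the mesh $\mathcal T'=\mathtt{refine}(\mathcal T,\mathcal M)$ is a conforming triangulation of $\Omega$, each of its elements is contained in an element of $\mathcal T$, and $\mathcal M\subseteq\mathcal T\setminus\mathcal T'$. Assume: * (sons) $\#(\mathcal T\setminus\mathcal T')+\#\mathcal T\le\#\mathcal T'$ for all $\mathcal T\in\mathbb T$, $\mathcal T'\in\mathbb T(\mathcal T)$; * (closure) for every sequence with $\mathcal T_{j+1}=\mathtt{refine}(\mathcal T_j,\mathcal M_j)$, $\mathcal M_j\subseteq\mathcal T_j$,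 starting from $\mathcal T_0$: $\#\mathcal T_\ell-\#\mathcal T_0\le C_{\rm cls}\sum_{j=0}^{\ell-1}\#\mathcal M_j$ for all $\ell$; * (overlay) any $\mathcal T,\mathcal T'\in\mathbb T$ have a common refinement $\mathcal S\in\mathbb T(\mathcal T)\cap\mathbb T(\mathcal T')$ with $\#\mathcal S\le\#\mathcal T+\#\mathcal T'-\#\mathcal T_0$. **Estimators.** For $\mathcal T\in\mathbb T$, $v\in\mathcal X_{\mathcal T}$, $T\in\mathcal T$ let indicators $\eta_{\mathcal T}(T,v),\zeta_{\mathcal T}(T,v)\ge0$ be given. For $\mu\in\{\eta,\zeta\}$ and $\mathcal U\subseteq\mathcal T$ write $\mu_{\mathcal T}(\mathcal U,v):=(\sum_{T\in\mathcal U}\mu_{\mathcal T}(T,v)^2)^{1/2}$ and $\mu_{\mathcal T}(v):=\mu_{\mathcal T}(\mathcal T,v)$. Assume that there are constants $C_{\rm stab},C_{\rm rel},C_{\rm drel}>0$, $0<q_{\rm red}<1$ such that for all $\mathcal T\in\mathbb T$, $\mathcal T'\in\mathbb T(\mathcal T)$, $v\in\mathcal X_{\mathcal T}$, $v'\in\mathcal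 X_{\mathcal T'}$, $\mathcal U\subseteq\mathcal T\cap\mathcal T'$: * (A1) $|\eta_{\mathcal T'}(\mathcal U,v')-\eta_{\mathcal T}(\mathcal U,v)|+|\zeta_{\mathcal T'}(\mathcal U,v')-\zeta_{\mathcal T}(\mathcal U,v)|\le C_{\rm stab}|||v'-v|||$; * (A2) $\mu_{\mathcal T'}(\mathcal T'\setminus\mathcal T,v)\le q_{\rm red}\,\mu_{\mathcal T}(\mathcal T\setminus\mathcal T',v)$ for $\mu\in\{\eta,\zeta\}$; * (A3) $|||u^\star-u^\star_{\mathcal T}|||\le C_{\rm rel}\,\eta_{\mathcal T}(u^\star_{\mathcal T})$ and $|||z^\star-z^\star_{\mathcal T}|||\le C_{\rm rel}\,\zeta_{\mathcal T}(z^\star_{\mathcal T})$; * (A4) $|||u^\star_{\mathcal T'}-u^\star_{\mathcal T}|||\le C_{\rm drel}\,\eta_{\mathcal T}(\mathcal T\setminus\mathcal T',u^\star_{\mathcal T})$ and $|||z^\star_{\mathcal T'}-z^\star_{\mathcal T}|||\le C_{\rm drel}\,\zeta_{\mathcal T}(\mathcal T\setminus\mathcal T',z^\star_{\mathcal T})$.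 **Algorithm.** Let $0<\theta\le1$, $\lambda_{\rm ctr}>0$, $0<q_{\rm ctr}<1$, and $u_0^0,z_0^0\in\mathcal X_0$. We abbreviate the index $\mathcal T_\ell$ by $\ell$. For $\ell=0,1,2,\dots$: 1. The solver computes $u_\ell^1,u_\ell^2,\dots\in\mathcal X_\ell$ with $|||u_\ell^\star-u_\ell^k|||\le q_{\rm ctr}|||u_\ell^\star-u_\ell^{k-1}|||$ until the first index $k=\underline m(\ell)\ge1$ with $|||u_\ell^k-u_\ell^{k-1}|||\le\lambda_{\rm ctr}\eta_\ell(u_\ell^k)$, and likewise, independently, $z_\ell^1,z_\ell^2,\dots\in\mathcal X_\ell$ with $|||z_\ell^\star-z_\ell^k|||\le q_{\rm ctr}|||z_\ell^\star-z_\ell^{k-1}|||$ until the first index $k=\underline n(\ell)\ge1$ with $|||z_\ell^k-z_\ell^{k-1}|||\le\lambda_{\rm ctr}\zeta_\ell(z_\ell^k)$. If there is no such index, then $\underline m(\ell)=\infty$ or $\underline n(\ell)=\infty$, respectively, and $\underline\ell:=\ell$. Let $\underline k(\ell):=\max\{\underline m(\ell),\underline n(\ell)\}$ and $u_\ell^k:=u_\ell^{\underline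 m(\ell)}$ for $\underline m(\ell)<k\le\underline k(\ell)$, $z_\ell^k:=z_\ell^{\underline n(\ell)}$ for $\underline n(\ell)<k\le\underline k(\ell)$. 2. If $\eta_\ell(u_\ell^{\underline m(\ell)})=0$ or $\zeta_\ell(z_\ell^{\underline n(\ell)})=0$, set $\underline\ell:=\ell$ and terminate. 3. Otherwise, writing $u=u_\ell^{\underline m(\ell)}$, $z=z_\ell^{\underline n(\ell)}$, find $\mathcal M_\ell\subseteq\mathcal T_\ell$ with $2\theta\,\eta_\ell(u)^2\zeta_\ell(z)^2\le\eta_\ell(\mathcal M_\ell,u)^2\zeta_\ell(z)^2+\zeta_\ell(\mathcal M_\ell,z)^2\eta_\ell(u)^2$. 4. Set $\mathcal T_{\ell+1}:=\mathtt{refine}(\mathcal T_\ell,\mathcal M_\ell)$, $u_{\ell+1}^0:=u$, $z_{\ell+1}^0:=z$. If the algorithm never stops, $\underline\ell:=\infty$. Let $1\le C_{\rm mark}<\infty$. On each level $\ell<\underline\ell$, the set $\mathcal M_\ell$ is constructed by one of the following strategies with some $0<\vartheta\le1$, where "quasi-minimal" means that the set is a subset of $\mathcal T_\ell$ whose cardinality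 is at most $C_{\rm mark}$ times that of any other subset of $\mathcal T_\ell$ satisfying the same inequality: * (a) $\theta=\vartheta^2$ and $\mathcal M_\ell$ is quasi-minimal with $\vartheta\rho_\ell\le\rho_\ell(\mathcal M_\ell)$, where $\rho_\ell(T)^2:=\eta_\ell(T,u)^2\zeta_\ell(z)^2+\eta_\ell(u)^2\zeta_\ell(T,z)^2$, $\rho_\ell(\mathcal U):=(\sum_{T\in\mathcal U}\rho_\ell(T)^2)^{1/2}$, and $\rho_\ell:=\rho_\ell(\mathcal T_\ell)$; * (b) $\theta=\vartheta^2/2$, $\overline{\mathcal M}^u$ and $\overline{\mathcal M}^z$ are quasi-minimal with $\vartheta\eta_\ell(u)\le\eta_\ell(\overline{\mathcal M}^u,u)$ and $\vartheta\zeta_\ell(z)\le\zeta_\ell(\overline{\mathcal M}^z,z)$, respectively, and $\mathcal M_\ell$ is one of these two sets with smallest cardinality; * (c) $\theta=\vartheta^2/2$ and, with $\overline{\mathcal M}^u,\overline{\mathcal M}^z$ as in (b), $\mathcal M_\ell=\mathcal M^u\cup\mathcal M^z$ for some $\mathcal M^u\subseteq\overline{\mathcal M}^u$, $\mathcal M^z\subseteq\overline{\mathcal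 M}^z$ with $\#\mathcal M^u=\#\mathcal M^z=\min\{\#\overline{\mathcal M}^u,\#\overline{\mathcal M}^z\}$. **Notation.** Let $\mathcal Q:=\{(\ell,k)\in\mathbb N_0^2:\ell\le\underline\ell,\ 1\le k\le\underline k(\ell)\}$, $|(\ell,k)|:=k+\sum_{j<\ell}\underline k(j)$, and $$\mathtt{work}(\ell,k):=\sum_{(\ell',k')\in\mathcal Q,\ |(\ell',k')|\le|(\ell,k)|}\#\mathcal T_{\ell'},\qquad \Lambda_\ell^k:=\big[|||u_\ell^\star-u_\ell^k|||+\eta_\ell(u_\ell^k)\big]\big[|||z_\ell^\star-z_\ell^k|||+\zeta_\ell(z_\ell^k)\big].$$ For $r>0$ let $$\|u^\star\|_{\mathbb A_r}:=\sup_{N\in\mathbb N_0}(N+1)^r\min_{\mathcal T\in\mathbb T,\ \#\mathcal T-\#\mathcal T_0\le N}\eta_{\mathcal T}(u_{\mathcal T}^\star),\qquad \|z^\star\|_{\mathbb A_r}:=\sup_{N\in\mathbb N_0}(N+1)^r\min_{\mathcal T\in\mathbb T,\ \#\mathcal T-\#\mathcal T_0\le N}\zeta_{\mathcal T}(z_{\mathcal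 T}^\star).$$ **Theorem.** Let $\theta_\star:=1/(1+C_{\rm stab}^2C_{\rm drel}^2)$ and $\lambda_\star:=(1-q_{\rm ctr})/(q_{\rm ctr}C_{\rm stab})$. Let $0<\theta\le1$ and $0<\lambda_{\rm ctr}<\lambda_\star$ be such that $$0<\Big(\frac{\sqrt{2\theta}+\lambda_{\rm ctr}/\lambda_\star}{1-\lambda_{\rm ctr}/\lambda_\star}\Big)^2<\theta_\star,$$ and let $s,t>0$ with $\|u^\star\|_{\mathbb A_s}+\|z^\star\|_{\mathbb A_t}<\infty$. Then there exists a constant $C_{\rm opt}>0$ such that $$\sup_{(\ell,k)\in\mathcal Q}\mathtt{work}(\ell,k)^{s+t}\Lambda_\ell^k\le C_{\rm opt}\max\{\|u^\star\|_{\mathbb A_s}\|z^\star\|_{\mathbb A_t},\Lambda_0^0\}.$$ The constant $C_{\rm opt}$ depends only on $C_{\rm cls},C_{\rm stab},q_{\rm red},C_{\rm rel},C_{\rm drel},q_{\rm ctr},C_{\rm mark},\theta,\lambda_{\rm ctr},\#\mathcal T_0,s,t$. -/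

import Mathlib

open MeasureTheory

open scoped ENNReal NNReal ContDiff Classical Matrix

noncomputable section

namespace GOAFEM

/-- The Euclidean space `ℝ^d`. -/
abbrev Pt (d : ℕ) := EuclideanSpace ℝ (Fin d)

/-! ### Domain and the Sobolev space `H¹₀(Ω)` -/

/-- Bounded Lipschitz domain: open, connected, bounded, and near every boundary point `Ω` is the
set above the graph of a Lipschitz function `γ` in some direction `e` (`γ` does not depend on the
coordinate in direction `e`). -/
structure IsBoundedLipschitzDomain {d : ℕ} (Ω : Set (Pt d)) : Prop where
  isOpen : IsOpen Ω
  isConnected : IsConnected Ω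
  isBounded : Bornology.IsBounded Ω
  graph : ∀ x ∈ frontier Ω, ∃ (e : Pt d) (K : ℝ≥0) (γ : Pt d → ℝ) (r : ℝ),
    ‖e‖ = 1 ∧ LipschitzWith K γ ∧ (∀ (y : Pt d) (τ : ℝ), γ (y + τ • e) = γ y) ∧ 0 < r ∧
      ∀ y ∈ Metric.ball x r, (y ∈ Ω ↔ γ y < inner ℝ e y)

/-- `L²(Ω) × L²(Ω)^d` with the Hilbert norm `(‖v‖² + ‖w‖²)^{1/2}`. -/
abbrev L2Pair {d : ℕ} (Ω : Set (Pt d)) :=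
  WithLp 2 (Lp ℝ 2 (volume.restrict Ω) × Lp (Pt d) 2 (volume.restrict Ω))

/-- `H¹₀(Ω)`, the closure of `C_c^∞(Ω)` in the `H¹(Ω)`-norm; a function `v` is stored as the pair
`(v, ∇v)`, so that the inherited norm is `(‖v‖²_{L²} + ‖∇v‖²_{L²})^{1/2}`. -/
def H10 {d : ℕ} (Ω : Set (Pt d)) : Submodule ℝ (L2Pair Ω) :=
  (Submodule.span ℝ {w : L2Pair Ω | ∃ φ : Pt d → ℝ, ContDiff ℝ ∞ φ ∧ HasCompactSupport φ ∧
    tsupport φ ⊆ Ω ∧ (w.fst : Pt d → ℝ) =ᵐ[volume.restrict Ω] φ ∧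
    (w.snd : Pt d → Pt d) =ᵐ[volume.restrict Ω] gradient φ}).topologicalClosure

/-- The values of `v ∈ H¹₀(Ω)`. -/
def val {d : ℕ} {Ω : Set (Pt d)} (v : H10 Ω) : Pt d → ℝ := (v : L2Pair Ω).fst

/-- The weak gradient of `v ∈ H¹₀(Ω)`. -/
def grad {d : ℕ} {Ω : Set (Pt d)} (v : H10 Ω) : Pt d → Pt d := (v : L2Pair Ω).snd

/-! ### The model problem -/

/-- `a(v, w) = ∫_Ω A ∇v · ∇w dx + ∫_Ω c v w dx`. -/
def energyForm {d : ℕ} {Ω : Set (Pt d)} (A : Pt d → Matrix (Fin d) (Fin d) ℝ) (c : Pt d → ℝ)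
    (v w : H10 Ω) : ℝ :=
  (∫ x in Ω, (A x *ᵥ (grad v x).ofLp) ⬝ᵥ (grad w x).ofLp) + ∫ x in Ω, c x * val v x * val w x

/-- The functional `v ↦ ∫_Ω (f v - F · ∇v) dx`. -/
def loadFunctional {d : ℕ} {Ω : Set (Pt d)} (f : Pt d → ℝ) (F : Pt d → Pt d) (v : H10 Ω) : ℝ :=
  ∫ x in Ω, (f x * val v x - inner ℝ (F x) (grad v x))

/-- The data of the model problem: domain, coefficients, right-hand side and goal functional.
(Continuity of the bilinear form follows from the boundedness of the coefficients.) -/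
structure ModelProblem (d : ℕ) where
  Ω : Set (Pt d)
  domain : IsBoundedLipschitzDomain Ω
  A : Pt d → Matrix (Fin d) (Fin d) ℝ
  c : Pt d → ℝ
  f : Pt d → ℝ
  fvec : Pt d → Pt d
  g : Pt d → ℝ
  gvec : Pt d → Pt d
  A_bounded : ∀ i j, MemLp (fun x => A x i j) ∞ (volume.restrict Ω)
  A_symm : ∀ᵐ x ∂volume.restrict Ω, (A x).IsSymm
  A_posDef : ∃ α : ℝ, 0 < α ∧ ∀ᵐ x ∂volume.restrict Ω, ∀ ξ : Fin d → ℝ,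
    α * (ξ ⬝ᵥ ξ) ≤ (A x *ᵥ ξ) ⬝ᵥ ξ
  c_bounded : MemLp c ∞ (volume.restrict Ω)
  f_L2 : MemLp f 2 (volume.restrict Ω)
  fvec_L2 : MemLp fvec 2 (volume.restrict Ω)
  g_L2 : MemLp g 2 (volume.restrict Ω)
  gvec_L2 : MemLp gvec 2 (volume.restrict Ω)
  elliptic : ∃ Cell : ℝ, 0 < Cell ∧ ∀ v : H10 Ω, Cell * ‖v‖ ^ 2 ≤ energyForm A c v v

namespace ModelProblem

variable {d : ℕ} (P : ModelProblem d)

/-- The space `H¹₀(Ω)` of the model problem. -/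
abbrev V := H10 P.Ω

/-- The bilinear form `a(·,·)`. -/
def a (v w : P.V) : ℝ := energyForm P.A P.c v w

/-- The energy norm. -/
def enorm (v : P.V) : ℝ := √(P.a v v)

/-- The right-hand side `F`. -/
def F (v : P.V) : ℝ := loadFunctional P.f P.fvec v

/-- The goal functional `G`. -/
def G (v : P.V) : ℝ := loadFunctional P.g P.gvec v

end ModelProblem

/-! ### Triangulations and finite element spaces -/

/-- A simplex is given by its set of vertices; as a point set it is the convex hull. -/
abbrev Simplex (d : ℕ) := Finset (Pt d)

/-- A mesh is a finite set of simplices. -/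
abbrev Mesh (d : ℕ) := Finset (Simplex d)

/-- The compact set covered by a simplex. -/
def body {d : ℕ} (T : Simplex d) : Set (Pt d) := convexHull ℝ (T : Set (Pt d))

/-- Conforming triangulation of `Ω` into compact (non-degenerate) simplices. -/
structure IsConforming {d : ℕ} (Ω : Set (Pt d)) (𝒯 : Mesh d) : Prop where
  card_vertices : ∀ T ∈ 𝒯, T.card = d + 1
  affineIndependent : ∀ T ∈ 𝒯, AffineIndependent ℝ (fun x : T => (x : Pt d))
  cover : ⋃ T ∈ 𝒯, body T = closure Ω
  common_face : ∀ T ∈ 𝒯, ∀ T' ∈ 𝒯, body T ∩ body T' = body (T ∩ T')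

/-- `𝒳_H`: all `v ∈ H¹₀(Ω)` that coincide on each element with a polynomial of degree `≤ p`. -/
def feSpace {d : ℕ} (Ω : Set (Pt d)) (p : ℕ) (𝒯 : Mesh d) : Submodule ℝ (H10 Ω) where
  carrier := {v | ∀ T ∈ 𝒯, ∃ q : MvPolynomial (Fin d) ℝ, q.totalDegree ≤ p ∧
    ∀ᵐ x ∂volume.restrict Ω, x ∈ body T → val v x = MvPolynomial.eval x.ofLp q}
  zero_mem' := by
    intro T _
    refine ⟨0, by simp, ?_⟩
    filter_upwards [Lp.coeFn_zero ℝ 2 (volume.restrict Ω)] with x hx _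
    simpa [val] using hx
  add_mem' := by
    intro v w hv hw T hT
    obtain ⟨q, hq, h1⟩ := hv T hT
    obtain ⟨r, hr, h2⟩ := hw T hT
    refine ⟨q + r, (MvPolynomial.totalDegree_add q r).trans (max_le hq hr), ?_⟩
    filter_upwards [h1, h2, Lp.coeFn_add (v : L2Pair Ω).fst (w : L2Pair Ω).fst] with x h1 h2 h3 hx
    rw [map_add, ← h1 hx, ← h2 hx]
    simpa [val] using h3
  smul_mem' := by
    intro τ v hv T hT
    obtain ⟨q, hq, h1⟩ := hv T hT
    refine ⟨τ • q, (MvPolynomial.totalDegree_smul_le τ q).trans hq, ?_⟩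
    filter_upwards [h1, Lp.coeFn_smul τ (v : L2Pair Ω).fst] with x h1 h3 hx
    rw [MvPolynomial.smul_eval, ← h1 hx]
    simpa [val] using h3

/-- The space `𝒳_H` of the model problem. -/
def ModelProblem.X {d : ℕ} (P : ModelProblem d) (p : ℕ) (𝒯 : Mesh d) : Submodule ℝ P.V :=
  feSpace P.Ω p 𝒯

/-- `u` is the weak solution of the primal problem. -/
def IsPrimalSolution {d : ℕ} (P : ModelProblem d) (u : P.V) : Prop :=
  ∀ v : P.V, P.a u v = P.F v

/-- `z` is the weak solution of the dual problem. -/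
def IsDualSolution {d : ℕ} (P : ModelProblem d) (z : P.V) : Prop :=
  ∀ v : P.V, P.a v z = P.G v

/-- `u` is the exact discrete primal solution in `𝒳_H`. -/
def IsDiscretePrimal {d : ℕ} (P : ModelProblem d) (p : ℕ) (𝒯 : Mesh d) (u : P.V) : Prop :=
  u ∈ P.X p 𝒯 ∧ ∀ v ∈ P.X p 𝒯, P.a u v = P.F v

/-- `z` is the exact discrete dual solution in `𝒳_H`. -/
def IsDiscreteDual {d : ℕ} (P : ModelProblem d) (p : ℕ) (𝒯 : Mesh d) (z : P.V) : Prop :=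
  z ∈ P.X p 𝒯 ∧ ∀ v ∈ P.X p 𝒯, P.a v z = P.G v

/-! ### Mesh refinement -/

/-- A refinement routine maps a mesh and a set of marked elements to a new mesh. -/
abbrev Refinement (d : ℕ) := Mesh d → Mesh d → Mesh d

/-- `𝕋(𝒯)`: all meshes obtained from `𝒯` by finitely many steps of refinement. -/
def refinements {d : ℕ} (refine : Refinement d) (𝒯 : Mesh d) : Set (Mesh d) :=
  {𝒯' | Relation.ReflTransGen (fun 𝒮 𝒮' => ∃ ℳ ⊆ 𝒮, 𝒮' = refine 𝒮 ℳ) 𝒯 𝒯'}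

/-- `refine` is a mesh-refinement strategy for the initial conforming triangulation `𝒯₀` of `Ω`:
on all meshes it can produce from `𝒯₀`, the refined mesh is again a conforming triangulation, its
elements are contained in elements of the old mesh, and all marked elements are refined.
(That it is the coarsest such mesh is not required here.) -/
structure IsRefinementStrategy {d : ℕ} (Ω : Set (Pt d)) (refine : Refinement d) (𝒯₀ : Mesh d) :
    Prop where
  initial : IsConforming Ω 𝒯₀
  conforming : ∀ 𝒯 ∈ refinements refine 𝒯₀, ∀ ℳ ⊆ 𝒯, IsConforming Ω (refine 𝒯 ℳ)
  subdivides : ∀ 𝒯 ∈ refinements refine 𝒯₀, ∀ ℳ ⊆ 𝒯, ∀ T' ∈ refine 𝒯 ℳ, ∃ T ∈ 𝒯, body T' ⊆ body T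
  marked_refined : ∀ 𝒯 ∈ refinements refine 𝒯₀, ∀ ℳ ⊆ 𝒯, ℳ ⊆ 𝒯 \ refine 𝒯 ℳ

/-- Each refined element has at least two sons. -/
def SonsProperty {d : ℕ} (refine : Refinement d) (𝒯₀ : Mesh d) : Prop :=
  ∀ 𝒯 ∈ refinements refine 𝒯₀, ∀ 𝒯' ∈ refinements refine 𝒯, (𝒯 \ 𝒯').card + 𝒯.card ≤ 𝒯'.card

/-- The mesh-closure estimate. -/
def ClosureEstimate {d : ℕ} (refine : Refinement d) (𝒯₀ : Mesh d) (Ccls : ℝ) : Prop :=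
  ∀ 𝒯 ℳ : ℕ → Mesh d, 𝒯 0 = 𝒯₀ → ∀ ℓ : ℕ,
    (∀ j < ℓ, ℳ j ⊆ 𝒯 j ∧ 𝒯 (j + 1) = refine (𝒯 j) (ℳ j)) →
      ((𝒯 ℓ).card : ℝ) - (𝒯₀.card : ℝ) ≤ Ccls * ∑ j ∈ Finset.range ℓ, ((ℳ j).card : ℝ)

/-- The overlay estimate. -/
def OverlayEstimate {d : ℕ} (refine : Refinement d) (𝒯₀ : Mesh d) : Prop :=
  ∀ 𝒯 ∈ refinements refine 𝒯₀, ∀ 𝒯' ∈ refinements refine 𝒯₀,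
    ∃ 𝒮 ∈ refinements refine 𝒯 ∩ refinements refine 𝒯', 𝒮.card + 𝒯₀.card ≤ 𝒯.card + 𝒯'.card

/-! ### Estimators and the axioms of adaptivity -/

/-- `(∑_{T ∈ 𝒰} μ(T)²)^{1/2}`. -/
def total {d : ℕ} (μ : Simplex d → ℝ) (𝒰 : Mesh d) : ℝ := √(∑ T ∈ 𝒰, μ T ^ 2)

/-- Refinement indicators: `η 𝒯_H v T` stands for `η_H(T, v)`; only the values for `T ∈ 𝒯_H` and
`v ∈ 𝒳_H` matter. -/
abbrev Indicators {d : ℕ} (P : ModelProblem d) := Mesh d → P.V → Simplex d → ℝ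

/-- Nonnegativity of the refinement indicators. -/
def NonnegIndicators {d : ℕ} (P : ModelProblem d) (p : ℕ) (refine : Refinement d) (𝒯₀ : Mesh d)
    (η : Indicators P) : Prop :=
  ∀ 𝒯 ∈ refinements refine 𝒯₀, ∀ v ∈ P.X p 𝒯, ∀ T ∈ 𝒯, 0 ≤ η 𝒯 v T

/-- Stability. -/
def Stability {d : ℕ} (P : ModelProblem d) (p : ℕ) (refine : Refinement d) (𝒯₀ : Mesh d)
    (η ζ : Indicators P) (Cstab : ℝ) : Prop :=
  ∀ 𝒯 ∈ refinements refine 𝒯₀, ∀ 𝒯' ∈ refinements refine 𝒯, ∀ v' ∈ P.X p 𝒯', ∀ v ∈ P.X p 𝒯,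
    ∀ 𝒰 ⊆ 𝒯' ∩ 𝒯,
      |total (η 𝒯' v') 𝒰 - total (η 𝒯 v) 𝒰| + |total (ζ 𝒯' v') 𝒰 - total (ζ 𝒯 v) 𝒰|
        ≤ Cstab * P.enorm (v' - v)

/-- Reduction (for one of the two estimators). -/
def Reduction {d : ℕ} (P : ModelProblem d) (p : ℕ) (refine : Refinement d) (𝒯₀ : Mesh d)
    (η : Indicators P) (qred : ℝ) : Prop :=
  ∀ 𝒯 ∈ refinements refine 𝒯₀, ∀ 𝒯' ∈ refinements refine 𝒯, ∀ v ∈ P.X p 𝒯,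
    total (η 𝒯' v) (𝒯' \ 𝒯) ≤ qred * total (η 𝒯 v) (𝒯 \ 𝒯')

/-- Reliability (for one of the two estimators), where `w` is the exact solution and `wD 𝒯`
is the exact discrete solution for the mesh `𝒯`. -/
def Reliability {d : ℕ} (P : ModelProblem d) (refine : Refinement d) (𝒯₀ : Mesh d)
    (η : Indicators P) (w : P.V) (wD : Mesh d → P.V) (Crel : ℝ) : Prop :=
  ∀ 𝒯 ∈ refinements refine 𝒯₀, P.enorm (w - wD 𝒯) ≤ Crel * total (η 𝒯 (wD 𝒯)) 𝒯

/-- Discrete reliability (for one of the two estimators). -/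
def DiscreteReliability {d : ℕ} (P : ModelProblem d) (refine : Refinement d) (𝒯₀ : Mesh d)
    (η : Indicators P) (wD : Mesh d → P.V) (Cdrel : ℝ) : Prop :=
  ∀ 𝒯 ∈ refinements refine 𝒯₀, ∀ 𝒯' ∈ refinements refine 𝒯,
    P.enorm (wD 𝒯' - wD 𝒯) ≤ Cdrel * total (η 𝒯 (wD 𝒯)) (𝒯 \ 𝒯')

/-- `‖w‖_{𝔸_r} = sup_N (N+1)^r min_{𝒯 ∈ 𝕋(N)} η_𝒯(w_𝒯)`, where `𝕋(N)` consists of all meshes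
`𝒯 ∈ 𝕋` with `#𝒯 - #𝒯₀ ≤ N`. -/
def approxNorm {d : ℕ} (P : ModelProblem d) (refine : Refinement d) (𝒯₀ : Mesh d)
    (η : Indicators P) (wD : Mesh d → P.V) (r : ℝ) : ℝ≥0∞ :=
  ⨆ N : ℕ, ((N : ℝ≥0∞) + 1) ^ r *
    ⨅ 𝒯 ∈ {𝒯 | 𝒯 ∈ refinements refine 𝒯₀ ∧ 𝒯.card ≤ 𝒯₀.card + N},
      ENNReal.ofReal (total (η 𝒯 (wD 𝒯)) 𝒯)

/-! ### Marking strategies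

Here `η` and `ζ` are the indicators of the current primal and dual iterates on the mesh `𝒯`. -/

/-- The marking criterion of the algorithm. -/
def MarkingCriterion {d : ℕ} (𝒯 : Mesh d) (η ζ : Simplex d → ℝ) (θ : ℝ) (ℳ : Mesh d) : Prop :=
  2 * θ * total η 𝒯 ^ 2 * total ζ 𝒯 ^ 2
    ≤ total η ℳ ^ 2 * total ζ 𝒯 ^ 2 + total ζ ℳ ^ 2 * total η 𝒯 ^ 2

/-- The Dörfler criterion `ϑ μ(𝒯) ≤ μ(ℳ)`. -/
def Doerfler {d : ℕ} (𝒯 : Mesh d) (μ : Simplex d → ℝ) (ϑ : ℝ) (ℳ : Mesh d) : Prop :=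
  ϑ * total μ 𝒯 ≤ total μ ℳ

/-- `ℳ ⊆ 𝒯` satisfies the Dörfler criterion and has, up to the factor `Cmark`, minimal cardinality
among all such sets. -/
def QuasiMinDoerfler {d : ℕ} (𝒯 : Mesh d) (μ : Simplex d → ℝ) (ϑ Cmark : ℝ) (ℳ : Mesh d) : Prop :=
  ℳ ⊆ 𝒯 ∧ Doerfler 𝒯 μ ϑ ℳ ∧
    ∀ ℳ' ⊆ 𝒯, Doerfler 𝒯 μ ϑ ℳ' → (ℳ.card : ℝ) ≤ Cmark * (ℳ'.card : ℝ)

/-- The weighted indicator `ρ(T) = (η(T)² ζ² + η² ζ(T)²)^{1/2}`. -/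
def weighted {d : ℕ} (𝒯 : Mesh d) (η ζ : Simplex d → ℝ) (T : Simplex d) : ℝ :=
  √(η T ^ 2 * total ζ 𝒯 ^ 2 + total η 𝒯 ^ 2 * ζ T ^ 2)

/-- First strategy: Dörfler marking for the weighted estimator; `θ = ϑ²`. -/
def MarkingA {d : ℕ} (𝒯 : Mesh d) (η ζ : Simplex d → ℝ) (θ Cmark : ℝ) (ℳ : Mesh d) : Prop :=
  ∃ ϑ : ℝ, 0 < ϑ ∧ ϑ ≤ 1 ∧ θ = ϑ ^ 2 ∧ QuasiMinDoerfler 𝒯 (weighted 𝒯 η ζ) ϑ Cmark ℳ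

/-- Second strategy: separate Dörfler marking, then the smaller of the two sets; `θ = ϑ²/2`. -/
def MarkingB {d : ℕ} (𝒯 : Mesh d) (η ζ : Simplex d → ℝ) (θ Cmark : ℝ) (ℳ : Mesh d) : Prop :=
  ∃ ϑ : ℝ, 0 < ϑ ∧ ϑ ≤ 1 ∧ θ = ϑ ^ 2 / 2 ∧ ∃ ℳu ℳz : Mesh d,
    QuasiMinDoerfler 𝒯 η ϑ Cmark ℳu ∧ QuasiMinDoerfler 𝒯 ζ ϑ Cmark ℳz ∧
      ((ℳ = ℳu ∧ ℳu.card ≤ ℳz.card) ∨ (ℳ = ℳz ∧ ℳz.card ≤ ℳu.card))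

/-- Third strategy: separate Dörfler marking, then the union of two subsets whose cardinality is the
smaller of the two cardinalities; `θ = ϑ²/2`. -/
def MarkingC {d : ℕ} (𝒯 : Mesh d) (η ζ : Simplex d → ℝ) (θ Cmark : ℝ) (ℳ : Mesh d) : Prop :=
  ∃ ϑ : ℝ, 0 < ϑ ∧ ϑ ≤ 1 ∧ θ = ϑ ^ 2 / 2 ∧ ∃ ℳu ℳz : Mesh d,
    QuasiMinDoerfler 𝒯 η ϑ Cmark ℳu ∧ QuasiMinDoerfler 𝒯 ζ ϑ Cmark ℳz ∧
      ∃ ℳu' ⊆ ℳu, ∃ ℳz' ⊆ ℳz, ℳu'.card = min ℳu.card ℳz.card ∧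
        ℳz'.card = min ℳu.card ℳz.card ∧ ℳ = ℳu' ∪ ℳz'

/-! ### The adaptive algorithm -/

/-- The quantities generated by the adaptive algorithm: meshes `𝒯_ℓ`, marked sets `ℳ_ℓ`, iterates
`u_ℓ^k` and `z_ℓ^k`, the final indices `m(ℓ)` and `n(ℓ)` of the two solvers, and the final level. -/
structure Iteration {d : ℕ} (P : ModelProblem d) where
  mesh : ℕ → Mesh d
  marked : ℕ → Mesh d
  u : ℕ → ℕ → P.V
  z : ℕ → ℕ → P.V
  m : ℕ → ℕ∞
  n : ℕ → ℕ∞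
  last : ℕ∞

/-- One run of the iterative solver on a fixed mesh with discrete space `X` and exact discrete
solution `w'`: the iterates `w 0, w 1, …` lie in `X` and are contractive with factor `qctr`; the
solver stops at the first index `m ≥ 1` with `‖w m - w (m-1)‖ ≤ lam * est (w m)`, where `m = ⊤` if
there is none; for `m < k ≤ K`, the iterate `w k` is defined as `w m`. -/
structure IsSolverRun {d : ℕ} (P : ModelProblem d) (X : Submodule ℝ P.V) (w' : P.V)
    (est : P.V → ℝ) (qctr lam : ℝ) (w : ℕ → P.V) (m K : ℕ∞) : Prop where
  mem : ∀ k : ℕ, (k : ℕ∞) ≤ m → w k ∈ X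
  contraction : ∀ k : ℕ, 1 ≤ k → (k : ℕ∞) ≤ m →
    P.enorm (w' - w k) ≤ qctr * P.enorm (w' - w (k - 1))
  one_le : 1 ≤ m
  stopping : ∀ k : ℕ, m = k → P.enorm (w k - w (k - 1)) ≤ lam * est (w k)
  not_earlier : ∀ k : ℕ, 1 ≤ k → (k : ℕ∞) < m → ¬ P.enorm (w k - w (k - 1)) ≤ lam * est (w k)
  constant : ∀ j k : ℕ, m = j → j < k → (k : ℕ∞) ≤ K → w k = w j

namespace Iteration

variable {d : ℕ} {P : ModelProblem d} (I : Iteration P)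

/-- `k(ℓ) = max {m(ℓ), n(ℓ)}`. -/
def kmax (l : ℕ) : ℕ∞ := max (I.m l) (I.n l)

/-- The final primal iterate on level `ℓ` (meaningful if `m(ℓ)` is finite). -/
def uFinal (l : ℕ) : P.V := I.u l (I.m l).toNat

/-- The final dual iterate on level `ℓ` (meaningful if `n(ℓ)` is finite). -/
def zFinal (l : ℕ) : P.V := I.z l (I.n l).toNat

/-- The iteration `I` results from the adaptive algorithm started with `𝒯₀`. Here `uD` and `zD`
give the exact discrete solutions for every mesh. -/
structure IsOutput (p : ℕ) (refine : Refinement d) (𝒯₀ : Mesh d) (η ζ : Indicators P)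
    (uD zD : Mesh d → P.V) (qctr θ lam : ℝ) : Prop where
  mesh_zero : I.mesh 0 = 𝒯₀
  primal_solver : ∀ l : ℕ, (l : ℕ∞) ≤ I.last →
    IsSolverRun P (P.X p (I.mesh l)) (uD (I.mesh l))
      (fun v => total (η (I.mesh l) v) (I.mesh l)) qctr lam (I.u l) (I.m l) (I.kmax l)
  dual_solver : ∀ l : ℕ, (l : ℕ∞) ≤ I.last →
    IsSolverRun P (P.X p (I.mesh l)) (zD (I.mesh l))
      (fun v => total (ζ (I.mesh l) v) (I.mesh l)) qctr lam (I.z l) (I.n l) (I.kmax l)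
  terminate : ∀ l : ℕ, I.last = l → I.kmax l = ⊤ ∨
    total (η (I.mesh l) (I.uFinal l)) (I.mesh l) = 0 ∨
    total (ζ (I.mesh l) (I.zFinal l)) (I.mesh l) = 0
  proceed : ∀ l : ℕ, (l : ℕ∞) < I.last → I.kmax l ≠ ⊤ ∧
    total (η (I.mesh l) (I.uFinal l)) (I.mesh l) ≠ 0 ∧
    total (ζ (I.mesh l) (I.zFinal l)) (I.mesh l) ≠ 0
  marking : ∀ l : ℕ, (l : ℕ∞) < I.last → I.marked l ⊆ I.mesh l ∧
    MarkingCriterion (I.mesh l) (η (I.mesh l) (I.uFinal l)) (ζ (I.mesh l) (I.zFinal l)) θ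
      (I.marked l)
  refinement : ∀ l : ℕ, (l : ℕ∞) < I.last → I.mesh (l + 1) = refine (I.mesh l) (I.marked l)
  nested : ∀ l : ℕ, (l : ℕ∞) < I.last →
    I.u (l + 1) 0 = I.uFinal l ∧ I.z (l + 1) 0 = I.zFinal l

/-- On every level, the marked set is constructed by one of the three strategies, with
quasi-minimal cardinality. -/
def QuasiMinimalMarking (η ζ : Indicators P) (θ Cmark : ℝ) : Prop :=
  ∀ l : ℕ, (l : ℕ∞) < I.last →
    MarkingA (I.mesh l) (η (I.mesh l) (I.uFinal l)) (ζ (I.mesh l) (I.zFinal l)) θ Cmark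
      (I.marked l) ∨
    MarkingB (I.mesh l) (η (I.mesh l) (I.uFinal l)) (ζ (I.mesh l) (I.zFinal l)) θ Cmark
      (I.marked l) ∨
    MarkingC (I.mesh l) (η (I.mesh l) (I.uFinal l)) (ζ (I.mesh l) (I.zFinal l)) θ Cmark
      (I.marked l)

/-- The index set `𝒬` of all pairs `(ℓ, k)` with `ℓ ≤ last` and `1 ≤ k ≤ k(ℓ)`. -/
def Q : Set (ℕ × ℕ) := {q | (q.1 : ℕ∞) ≤ I.last ∧ 1 ≤ q.2 ∧ (q.2 : ℕ∞) ≤ I.kmax q.1}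

/-- The step counter `|(ℓ, k)| = k + ∑_{j < ℓ} k(j)`. -/
def steps (q : ℕ × ℕ) : ℕ∞ := (q.2 : ℕ∞) + ∑ j ∈ Finset.range q.1, I.kmax j

/-- `work(ℓ, k)`: the sum of `#𝒯_{ℓ'}` over all `(ℓ', k') ∈ 𝒬` with `|(ℓ', k')| ≤ |(ℓ, k)|`. -/
def work (q : ℕ × ℕ) : ℝ≥0∞ :=
  ∑' q' : {q' : ℕ × ℕ // q' ∈ I.Q ∧ I.steps q' ≤ I.steps q}, ((I.mesh q'.1.1).card : ℝ≥0∞)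

/-- The quasi-error product `Λ_ℓ^k`. -/
def Lam (η ζ : Indicators P) (uD zD : Mesh d → P.V) (q : ℕ × ℕ) : ℝ :=
  (P.enorm (uD (I.mesh q.1) - I.u q.1 q.2) + total (η (I.mesh q.1) (I.u q.1 q.2)) (I.mesh q.1)) *
  (P.enorm (zD (I.mesh q.1) - I.z q.1 q.2) + total (ζ (I.mesh q.1) (I.z q.1 q.2)) (I.mesh q.1))

end Iteration

end GOAFEM

end

open MeasureTheory

open scoped ENNReal NNReal ContDiff Classical Matrix

noncomputable section

namespace GOAFEM

/-! ### The energy form and its norm -/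

section EnergyForm

variable {d : ℕ} {Ω : Set (Pt d)}

/-! The theorem rests on two facts about the product Λ of the two quasi-errors: it decays linearly
along all steps of the algorithm, and the number of elements marked on a level is at most a multiple
of (‖u‖‖z‖/Λ)^(1/(s+t)). The closure estimate then bounds `#𝒯_ℓ` by a sum of reciprocal powers of Λ.
By linear decay this sum, and the further sum over all solver steps, is geometric and dominated by
its last term.

Decay across levels. The combined marking criterion makes at least one of the two estimators satisfy
a Dörfler criterion. For that problem the weighted quasi-error E² + νe² + γh² (Galerkin error,
solver error of the final iterate, estimator) contracts from the current level to every later level.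
For the other problem it is only quasi-monotone, and the constant of quasi-monotonicity could
destroy the decay of the product. Replacing each weighted quasi-error by its supremum over all later
levels removes that constant: the suprema never increase, and one of the two contracts on each level
(`exists_contraction_factor`, `exists_product_contraction`). Within a level, the violated stopping
criterion bounds the estimator by the solver increment; since the longer of the two solver runs is
still active, the product gains a factor `qctr` per step, up to a constant
(`IsSolverRun.quasiError_le`, `Lam_le_pow`).

Bound on marking. The current mesh is overlaid with one nearly optimal mesh for each problem, both
with the same number N of additional elements. The rates s and t add up, so for N of order
(‖u‖‖z‖/Λ)^(1/(s+t)) the product of the estimators drops by κ², and at least one estimator drops by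
κ (`exists_reducing_refinement`). By optimality of Dörfler marking the refined elements satisfy a
Dörfler criterion for that estimator, which passes to the computed iterate because `lam` is small.
Each marking strategy is quasi-minimal against such a set (`marked_card_le`).

The summation is `exists_optimality_const`; the term Λ_0^0 in the maximum pays for the elements of
the initial mesh. -/

lemma val_memLp (v : H10 Ω) : MemLp (val v) 2 (volume.restrict Ω) := Lp.memLp _

lemma grad_memLp (v : H10 Ω) : MemLp (grad v) 2 (volume.restrict Ω) := Lp.memLp _

lemma grad_apply_memLp (v : H10 Ω) (i : Fin d) :
    MemLp (fun x => (grad v x).ofLp i) 2 (volume.restrict Ω) :=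
  (EuclideanSpace.proj (𝕜 := ℝ) i).comp_memLp' (grad_memLp v)

lemma val_add (v w : H10 Ω) : val (v + w) =ᵐ[volume.restrict Ω] fun x => val v x + val w x :=
  Lp.coeFn_add (v : L2Pair Ω).fst (w : L2Pair Ω).fst

lemma grad_add (v w : H10 Ω) : grad (v + w) =ᵐ[volume.restrict Ω] fun x => grad v x + grad w x :=
  Lp.coeFn_add (v : L2Pair Ω).snd (w : L2Pair Ω).snd

lemma val_smul (τ : ℝ) (v : H10 Ω) : val (τ • v) =ᵐ[volume.restrict Ω] fun x => τ * val v x :=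
  Lp.coeFn_smul τ (v : L2Pair Ω).fst

lemma grad_smul (τ : ℝ) (v : H10 Ω) : grad (τ • v) =ᵐ[volume.restrict Ω] fun x => τ • grad v x :=
  Lp.coeFn_smul τ (v : L2Pair Ω).snd

lemma integrable_mul_mul {f g h : Pt d → ℝ} {μ : Measure (Pt d)} (hf : MemLp f ∞ μ)
    (hg : MemLp g 2 μ) (hh : MemLp h 2 μ) : Integrable (fun x => f x * g x * h x) μ := by
  have h1 : MemLp (fun x => f x * g x) 2 μ := MemLp.mul' hg hf
  exact memLp_one_iff_integrable.1 (MemLp.mul' hh h1)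

end EnergyForm

namespace ModelProblem

variable {d : ℕ} (P : ModelProblem d)

lemma integrable_reaction (v w : P.V) :
    Integrable (fun x => P.c x * val v x * val w x) (volume.restrict P.Ω) :=
  integrable_mul_mul P.c_bounded (val_memLp v) (val_memLp w)

lemma integrable_diffusion (v w : P.V) :
    Integrable (fun x => (P.A x *ᵥ (grad v x).ofLp) ⬝ᵥ (grad w x).ofLp)
      (volume.restrict P.Ω) := by
  simp only [dotProduct, Matrix.mulVec, Finset.sum_mul]
  exact integrable_finsetSum _ fun i _ => integrable_finsetSum _ fun j _ =>
    integrable_mul_mul (P.A_bounded i j) (grad_apply_memLp v j) (grad_apply_memLp w i)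

lemma a_add_left (u v w : P.V) : P.a (u + v) w = P.a u w + P.a v w := by
  have h1 : (∫ x in P.Ω, (P.A x *ᵥ (grad (u + v) x).ofLp) ⬝ᵥ (grad w x).ofLp) =
      (∫ x in P.Ω, (P.A x *ᵥ (grad u x).ofLp) ⬝ᵥ (grad w x).ofLp) +
        ∫ x in P.Ω, (P.A x *ᵥ (grad v x).ofLp) ⬝ᵥ (grad w x).ofLp := by
    rw [← integral_add (P.integrable_diffusion u w) (P.integrable_diffusion v w)]
    refine integral_congr_ae ?_
    filter_upwards [grad_add u v] with x hx
    simp only [hx, WithLp.ofLp_add, Matrix.mulVec_add, add_dotProduct]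
  have h2 : (∫ x in P.Ω, P.c x * val (u + v) x * val w x) =
      (∫ x in P.Ω, P.c x * val u x * val w x) + ∫ x in P.Ω, P.c x * val v x * val w x := by
    rw [← integral_add (P.integrable_reaction u w) (P.integrable_reaction v w)]
    refine integral_congr_ae ?_
    filter_upwards [val_add u v] with x hx
    simp only [hx]
    ring
  simp only [a, energyForm, h1, h2]
  ring

lemma a_smul_left (τ : ℝ) (v w : P.V) : P.a (τ • v) w = τ * P.a v w := by
  have h1 : (∫ x in P.Ω, (P.A x *ᵥ (grad (τ • v) x).ofLp) ⬝ᵥ (grad w x).ofLp) =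
      τ * ∫ x in P.Ω, (P.A x *ᵥ (grad v x).ofLp) ⬝ᵥ (grad w x).ofLp := by
    rw [← integral_const_mul]
    refine integral_congr_ae ?_
    filter_upwards [grad_smul τ v] with x hx
    simp only [hx, WithLp.ofLp_smul, Matrix.mulVec_smul, smul_dotProduct, smul_eq_mul]
  have h2 : (∫ x in P.Ω, P.c x * val (τ • v) x * val w x) =
      τ * ∫ x in P.Ω, P.c x * val v x * val w x := by
    rw [← integral_const_mul]
    refine integral_congr_ae ?_
    filter_upwards [val_smul τ v] with x hx
    simp only [hx]
    ring
  simp only [a, energyForm, h1, h2]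
  ring

lemma a_symm (v w : P.V) : P.a v w = P.a w v := by
  have h1 : (∫ x in P.Ω, (P.A x *ᵥ (grad v x).ofLp) ⬝ᵥ (grad w x).ofLp) =
      ∫ x in P.Ω, (P.A x *ᵥ (grad w x).ofLp) ⬝ᵥ (grad v x).ofLp := by
    refine integral_congr_ae ?_
    filter_upwards [P.A_symm] with x hx
    rw [← Matrix.vecMul_transpose, hx.eq, ← Matrix.dotProduct_mulVec, dotProduct_comm]
  have h2 : (∫ x in P.Ω, P.c x * val v x * val w x) = ∫ x in P.Ω, P.c x * val w x * val v x := by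
    congr 1
    ext x
    ring
  simp only [a, energyForm, h1, h2]

lemma a_self_nonneg (v : P.V) : 0 ≤ P.a v v := by
  obtain ⟨C, hC, h⟩ := P.elliptic
  exact (by positivity : 0 ≤ C * ‖v‖ ^ 2).trans (h v)

/-- The bilinear form `a(·,·)` as a bundled bilinear form. -/
def bilin : LinearMap.BilinForm ℝ P.V :=
  LinearMap.mk₂ ℝ P.a P.a_add_left P.a_smul_left
    (fun u v w => by rw [P.a_symm, P.a_add_left, P.a_symm v, P.a_symm w])
    (fun τ v w => by rw [P.a_symm, P.a_smul_left, P.a_symm w, smul_eq_mul])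

lemma bilin_apply (v w : P.V) : P.bilin v w = P.a v w := rfl

lemma a_mul_self_le (v w : P.V) : P.a v w * P.a v w ≤ P.a v v * P.a w w := by
  have := P.bilin.apply_mul_apply_le_of_forall_zero_le P.a_self_nonneg v w
  simpa only [bilin_apply, P.a_symm w v] using this

lemma enorm_nonneg (v : P.V) : 0 ≤ P.enorm v := Real.sqrt_nonneg _

lemma enorm_sq (v : P.V) : P.enorm v ^ 2 = P.a v v := Real.sq_sqrt (P.a_self_nonneg v)

lemma a_self_add (v w : P.V) : P.a (v + w) (v + w) = P.a v v + 2 * P.a v w + P.a w w := by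
  have h : P.bilin (v + w) (v + w) = P.bilin v v + 2 * P.bilin v w + P.bilin w w := by
    have := P.a_symm v w
    rw [← bilin_apply, ← bilin_apply] at this
    simp only [map_add, LinearMap.add_apply]
    linarith
  exact h

lemma enorm_zero : P.enorm 0 = 0 := by
  have h : P.bilin 0 0 = 0 := by simp
  rw [enorm, ← bilin_apply, h, Real.sqrt_zero]

lemma enorm_neg (v : P.V) : P.enorm (-v) = P.enorm v := by
  have h : P.bilin (-v) (-v) = P.bilin v v := by simp
  rw [enorm, enorm, ← bilin_apply, h, bilin_apply]

lemma enorm_add_le (v w : P.V) : P.enorm (v + w) ≤ P.enorm v + P.enorm w := by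
  have hv := P.enorm_nonneg v
  have hw := P.enorm_nonneg w
  refine abs_le_of_sq_le_sq' ?_ (by positivity) |>.2
  have h1 : P.a v w ≤ P.enorm v * P.enorm w := by
    refine abs_le_of_sq_le_sq' ?_ (by positivity) |>.2
    rw [mul_pow, P.enorm_sq, P.enorm_sq, sq]
    exact P.a_mul_self_le v w
  rw [P.enorm_sq, a_self_add, add_sq, P.enorm_sq, P.enorm_sq]
  linarith

lemma enorm_sub_comm (v w : P.V) : P.enorm (v - w) = P.enorm (w - v) := by
  rw [← P.enorm_neg, neg_sub]

lemma enorm_sub_le (u v w : P.V) : P.enorm (u - w) ≤ P.enorm (u - v) + P.enorm (v - w) := by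
  simpa using P.enorm_add_le (u - v) (v - w)

lemma enorm_sq_sub_eq (u v w : P.V) (h : P.a (u - v) (v - w) = 0) :
    P.enorm (u - w) ^ 2 = P.enorm (u - v) ^ 2 + P.enorm (v - w) ^ 2 := by
  have := P.a_self_add (u - v) (v - w)
  rw [sub_add_sub_cancel, h] at this
  simp only [P.enorm_sq, this]
  ring

lemma a_sub_left (u v w : P.V) : P.a (u - v) w = P.a u w - P.a v w := by
  have h : P.bilin (u - v) w = P.bilin u w - P.bilin v w := by simp
  exact h

end ModelProblem

/-! ### Refinement, nested spaces and the axioms for a single estimator -/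

section Refinement

variable {d : ℕ} {refine : Refinement d} {𝒯₀ : Mesh d}

lemma refinements_trans {𝒯 𝒯' 𝒯'' : Mesh d} (h : 𝒯' ∈ refinements refine 𝒯)
    (h' : 𝒯'' ∈ refinements refine 𝒯') : 𝒯'' ∈ refinements refine 𝒯 :=
  Relation.ReflTransGen.trans h h'

lemma self_mem_refinements (𝒯 : Mesh d) : 𝒯 ∈ refinements refine 𝒯 :=
  Relation.ReflTransGen.refl

lemma refine_mem_refinements {𝒯 ℳ : Mesh d} (h : ℳ ⊆ 𝒯) : refine 𝒯 ℳ ∈ refinements refine 𝒯 :=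
  Relation.ReflTransGen.single ⟨ℳ, h, rfl⟩

lemma feSpace_mono {Ω : Set (Pt d)} {p : ℕ} {𝒯 𝒯' : Mesh d}
    (h : ∀ T' ∈ 𝒯', ∃ T ∈ 𝒯, body T' ⊆ body T) : feSpace Ω p 𝒯 ≤ feSpace Ω p 𝒯' := by
  intro v hv T' hT'
  obtain ⟨T, hT, hsub⟩ := h T' hT'
  obtain ⟨q, hq, hae⟩ := hv T hT
  exact ⟨q, hq, hae.mono fun x hx hxT => hx (hsub hxT)⟩

lemma IsRefinementStrategy.X_mono {P : ModelProblem d} {p : ℕ}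
    (hR : IsRefinementStrategy P.Ω refine 𝒯₀) {𝒯 𝒯' : Mesh d}
    (h : 𝒯 ∈ refinements refine 𝒯₀) (h' : 𝒯' ∈ refinements refine 𝒯) : P.X p 𝒯 ≤ P.X p 𝒯' := by
  induction h' with
  | refl => exact le_rfl
  | tail hab hbc ih =>
    obtain ⟨ℳ, hℳ, rfl⟩ := hbc
    exact ih.trans (feSpace_mono (hR.subdivides _ (refinements_trans h hab) ℳ hℳ))

end Refinement

section Total

variable {d : ℕ} (μ : Simplex d → ℝ)

lemma total_nonneg (𝒰 : Mesh d) : 0 ≤ total μ 𝒰 := Real.sqrt_nonneg _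

lemma total_sq (𝒰 : Mesh d) : total μ 𝒰 ^ 2 = ∑ T ∈ 𝒰, μ T ^ 2 :=
  Real.sq_sqrt (Finset.sum_nonneg fun _ _ => sq_nonneg _)

lemma total_mono {𝒰 𝒰' : Mesh d} (h : 𝒰 ⊆ 𝒰') : total μ 𝒰 ≤ total μ 𝒰' :=
  Real.sqrt_le_sqrt (Finset.sum_le_sum_of_subset_of_nonneg h fun _ _ _ => sq_nonneg _)

lemma total_sq_inter_add_sdiff (𝒯 𝒯' : Mesh d) :
    total μ 𝒯 ^ 2 = total μ (𝒯 ∩ 𝒯') ^ 2 + total μ (𝒯 \ 𝒯') ^ 2 := by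
  simp only [total_sq]
  exact (Finset.sum_inter_add_sum_sdiff 𝒯 𝒯' _).symm

end Total

/-- The properties of one of the two estimators `μ` that enter the convergence analysis, where `w`
is the exact solution and `wD 𝒯` is the exact discrete solution for the mesh `𝒯`. -/
structure IsAdaptive {d : ℕ} (P : ModelProblem d) (p : ℕ) (refine : Refinement d) (𝒯₀ : Mesh d)
    (μ : Indicators P) (w : P.V) (wD : Mesh d → P.V) (Cstab qred Crel Cdrel : ℝ) : Prop where
  X_mono : ∀ 𝒯 ∈ refinements refine 𝒯₀, ∀ 𝒯' ∈ refinements refine 𝒯, P.X p 𝒯 ≤ P.X p 𝒯'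
  mem : ∀ 𝒯 ∈ refinements refine 𝒯₀, wD 𝒯 ∈ P.X p 𝒯
  pythagoras : ∀ 𝒯 ∈ refinements refine 𝒯₀, ∀ 𝒯' ∈ refinements refine 𝒯,
    P.enorm (w - wD 𝒯) ^ 2 = P.enorm (w - wD 𝒯') ^ 2 + P.enorm (wD 𝒯' - wD 𝒯) ^ 2
  stability : ∀ 𝒯 ∈ refinements refine 𝒯₀, ∀ 𝒯' ∈ refinements refine 𝒯, ∀ v' ∈ P.X p 𝒯',
    ∀ v ∈ P.X p 𝒯, ∀ 𝒰 ⊆ 𝒯' ∩ 𝒯,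
      |total (μ 𝒯' v') 𝒰 - total (μ 𝒯 v) 𝒰| ≤ Cstab * P.enorm (v' - v)
  reduction : Reduction P p refine 𝒯₀ μ qred
  reliability : Reliability P refine 𝒯₀ μ w wD Crel
  discreteReliability : DiscreteReliability P refine 𝒯₀ μ wD Cdrel

/-- Nestedness of the discrete spaces and Galerkin orthogonality give the Pythagoras identity;
stability for one estimator is the joint axiom with the other nonnegative term dropped. -/
lemma IsAdaptive.primal {d : ℕ} {P : ModelProblem d} {p : ℕ} {refine : Refinement d}
    {𝒯₀ : Mesh d} {η ζ : Indicators P} {u : P.V} {uD : Mesh d → P.V} {Cstab qred Crel Cdrel : ℝ}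
    (hR : IsRefinementStrategy P.Ω refine 𝒯₀) (hu : IsPrimalSolution P u)
    (hD : ∀ 𝒯 ∈ refinements refine 𝒯₀, IsDiscretePrimal P p 𝒯 (uD 𝒯))
    (hS : Stability P p refine 𝒯₀ η ζ Cstab) (hred : Reduction P p refine 𝒯₀ η qred)
    (hrel : Reliability P refine 𝒯₀ η u uD Crel)
    (hdrel : DiscreteReliability P refine 𝒯₀ η uD Cdrel) :
    IsAdaptive P p refine 𝒯₀ η u uD Cstab qred Crel Cdrel where
  X_mono 𝒯 h 𝒯' h' := hR.X_mono h h'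
  mem 𝒯 h := (hD 𝒯 h).1
  pythagoras 𝒯 h 𝒯' h' := by
    have h0' := refinements_trans h h'
    refine P.enorm_sq_sub_eq _ _ _ ?_
    have hmem : uD 𝒯' - uD 𝒯 ∈ P.X p 𝒯' :=
      sub_mem (hD 𝒯' h0').1 (hR.X_mono h h' (hD 𝒯 h).1)
    rw [P.a_sub_left, hu, (hD 𝒯' h0').2 _ hmem, sub_self]
  stability 𝒯 h 𝒯' h' v' hv' v hv 𝒰 h𝒰 :=
    (le_add_of_nonneg_right (abs_nonneg _)).trans (hS 𝒯 h 𝒯' h' v' hv' v hv 𝒰 h𝒰)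
  reduction := hred
  reliability := hrel
  discreteReliability := hdrel

/-- Symmetry of the form makes the dual problem one of primal type, so both problems can share all
later arguments. -/
lemma IsAdaptive.dual {d : ℕ} {P : ModelProblem d} {p : ℕ} {refine : Refinement d}
    {𝒯₀ : Mesh d} {η ζ : Indicators P} {z : P.V} {zD : Mesh d → P.V} {Cstab qred Crel Cdrel : ℝ}
    (hR : IsRefinementStrategy P.Ω refine 𝒯₀) (hz : IsDualSolution P z)
    (hD : ∀ 𝒯 ∈ refinements refine 𝒯₀, IsDiscreteDual P p 𝒯 (zD 𝒯))
    (hS : Stability P p refine 𝒯₀ η ζ Cstab) (hred : Reduction P p refine 𝒯₀ ζ qred)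
    (hrel : Reliability P refine 𝒯₀ ζ z zD Crel)
    (hdrel : DiscreteReliability P refine 𝒯₀ ζ zD Cdrel) :
    IsAdaptive P p refine 𝒯₀ ζ z zD Cstab qred Crel Cdrel where
  X_mono 𝒯 h 𝒯' h' := hR.X_mono h h'
  mem 𝒯 h := (hD 𝒯 h).1
  pythagoras 𝒯 h 𝒯' h' := by
    have h0' := refinements_trans h h'
    refine P.enorm_sq_sub_eq _ _ _ ?_
    have hmem : zD 𝒯' - zD 𝒯 ∈ P.X p 𝒯' :=
      sub_mem (hD 𝒯' h0').1 (hR.X_mono h h' (hD 𝒯 h).1)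
    rw [P.a_sub_left, P.a_symm z, P.a_symm (zD 𝒯'), hz, (hD 𝒯' h0').2 _ hmem, sub_self]
  stability 𝒯 h 𝒯' h' v' hv' v hv 𝒰 h𝒰 :=
    (le_add_of_nonneg_left (abs_nonneg _)).trans (hS 𝒯 h 𝒯' h' v' hv' v hv 𝒰 h𝒰)
  reduction := hred
  reliability := hrel
  discreteReliability := hdrel

end GOAFEM
-- Quasi-monotonicity and optimality of Dörfler marking
namespace GOAFEM

namespace IsAdaptive

variable {d : ℕ} {P : ModelProblem d} {p : ℕ} {refine : Refinement d} {𝒯₀ : Mesh d}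
  {μ : Indicators P} {w : P.V} {wD : Mesh d → P.V} {Cstab qred Crel Cdrel : ℝ}
  (H : IsAdaptive P p refine 𝒯₀ μ w wD Cstab qred Crel Cdrel)

include H

/-- Stability applied to one and the same function has right-hand side zero, so indicators on
unrefined elements do not see the change of mesh. -/
lemma total_eq_of_subset_inter {𝒯 𝒯' 𝒰 : Mesh d} (h : 𝒯 ∈ refinements refine 𝒯₀)
    (h' : 𝒯' ∈ refinements refine 𝒯) {v : P.V} (hv : v ∈ P.X p 𝒯) (h𝒰 : 𝒰 ⊆ 𝒯' ∩ 𝒯) :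
    total (μ 𝒯' v) 𝒰 = total (μ 𝒯 v) 𝒰 := by
  have := H.stability 𝒯 h 𝒯' h' v (H.X_mono 𝒯 h 𝒯' h' hv) v hv 𝒰 h𝒰
  rw [sub_self, P.enorm_zero, mul_zero] at this
  exact sub_eq_zero.1 (abs_nonpos_iff.1 this)

lemma total_le_add_enorm {𝒯 𝒰 : Mesh d} (h : 𝒯 ∈ refinements refine 𝒯₀) {v v' : P.V}
    (hv : v ∈ P.X p 𝒯) (hv' : v' ∈ P.X p 𝒯) (h𝒰 : 𝒰 ⊆ 𝒯) :
    total (μ 𝒯 v') 𝒰 ≤ total (μ 𝒯 v) 𝒰 + Cstab * P.enorm (v' - v) := by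
  have := (abs_le.1 (H.stability 𝒯 h 𝒯 (self_mem_refinements 𝒯) v' hv' v hv 𝒰
    (by simpa using h𝒰))).2
  linarith

lemma total_sq_refinement_le {𝒯 𝒯' : Mesh d}
    (h : 𝒯 ∈ refinements refine 𝒯₀) (h' : 𝒯' ∈ refinements refine 𝒯) {v : P.V}
    (hv : v ∈ P.X p 𝒯) :
    total (μ 𝒯' v) 𝒯' ^ 2 ≤
      total (μ 𝒯 v) 𝒯 ^ 2 - (1 - qred ^ 2) * total (μ 𝒯 v) (𝒯 \ 𝒯') ^ 2 := by
  have h1 := H.total_eq_of_subset_inter h h' hv (subset_refl _)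
  have h2 := pow_le_pow_left₀ (total_nonneg _ _) (H.reduction 𝒯 h 𝒯' h' v hv) 2
  rw [total_sq_inter_add_sdiff _ 𝒯' 𝒯, h1, total_sq_inter_add_sdiff _ 𝒯 𝒯',
    Finset.inter_comm 𝒯 𝒯']
  nlinarith

lemma total_refinement_le (hqred : 0 ≤ qred) (hqred₁ : qred < 1) {𝒯 𝒯' : Mesh d}
    (h : 𝒯 ∈ refinements refine 𝒯₀) (h' : 𝒯' ∈ refinements refine 𝒯) {v : P.V}
    (hv : v ∈ P.X p 𝒯) : total (μ 𝒯' v) 𝒯' ≤ total (μ 𝒯 v) 𝒯 := by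
  refine (abs_le_of_sq_le_sq' ?_ (total_nonneg _ _)).2
  have h1 := H.total_sq_refinement_le h h' hv
  have h2 : 0 ≤ (1 - qred ^ 2) * total (μ 𝒯 v) (𝒯 \ 𝒯') ^ 2 :=
    mul_nonneg (by nlinarith) (sq_nonneg _)
  linarith

lemma quasi_monotone (hqred : 0 ≤ qred) (hqred₁ : qred < 1) (hCstab : 0 ≤ Cstab)
    (hCdrel : 0 ≤ Cdrel) {𝒯 𝒯' : Mesh d} (h : 𝒯 ∈ refinements refine 𝒯₀)
    (h' : 𝒯' ∈ refinements refine 𝒯) :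
    total (μ 𝒯' (wD 𝒯')) 𝒯' ≤ (1 + Cstab * Cdrel) * total (μ 𝒯 (wD 𝒯)) 𝒯 := by
  have h0 := refinements_trans h h'
  have h1 := H.total_le_add_enorm h0 (H.X_mono 𝒯 h 𝒯' h' (H.mem 𝒯 h)) (H.mem 𝒯' h0)
    (subset_refl _)
  have h2 := H.total_refinement_le hqred hqred₁ h h' (H.mem 𝒯 h)
  have h3 := (H.discreteReliability 𝒯 h 𝒯' h').trans
    (mul_le_mul_of_nonneg_left (total_mono _ Finset.sdiff_subset) hCdrel)
  have h4 := mul_le_mul_of_nonneg_left h3 hCstab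
  linarith

/-- Optimality of Dörfler marking: the elements refined by a mesh on which the estimator is
substantially smaller satisfy a Dörfler criterion. -/
lemma doerfler_of_total_le {τ κ : ℝ} (hCstab : 0 ≤ Cstab) (hCdrel : 0 ≤ Cdrel)
    (hτκ : τ ^ 2 + (κ + Cstab * Cdrel * τ) ^ 2 ≤ 1) {𝒯 𝒯' : Mesh d}
    (h : 𝒯 ∈ refinements refine 𝒯₀) (h' : 𝒯' ∈ refinements refine 𝒯)
    (hle : total (μ 𝒯' (wD 𝒯')) 𝒯' ≤ κ * total (μ 𝒯 (wD 𝒯)) 𝒯) :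
    τ * total (μ 𝒯 (wD 𝒯)) 𝒯 ≤ total (μ 𝒯 (wD 𝒯)) (𝒯 \ 𝒯') := by
  -- If the refined elements carried less than the fraction τ, discrete reliability and stability
  -- would bound the unrefined part y by (κ + Cstab·Cdrel·τ)·e. Then y² + x² < e², although the two
  -- parts make up e².
  by_contra! hlt
  have h0 := refinements_trans h h'
  set x := total (μ 𝒯 (wD 𝒯)) (𝒯 \ 𝒯')
  set y := total (μ 𝒯 (wD 𝒯)) (𝒯' ∩ 𝒯)
  set e := total (μ 𝒯 (wD 𝒯)) 𝒯
  have hx : 0 ≤ x := total_nonneg _ _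
  have hy : 0 ≤ y := total_nonneg _ _
  have he : 0 ≤ e := total_nonneg _ _
  have hsq : e ^ 2 = y ^ 2 + x ^ 2 := by
    simp only [e, y, x]
    rw [total_sq_inter_add_sdiff _ 𝒯 𝒯', Finset.inter_comm]
  have h1 := (abs_le.1 (H.stability 𝒯 h 𝒯' h' _ (H.mem 𝒯' h0) _ (H.mem 𝒯 h) _
    (subset_refl _))).1
  have h2 : total (μ 𝒯' (wD 𝒯')) (𝒯' ∩ 𝒯) ≤ total (μ 𝒯' (wD 𝒯')) 𝒯' :=
    total_mono _ Finset.inter_subset_left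
  have h3 := mul_le_mul_of_nonneg_left (H.discreteReliability 𝒯 h 𝒯' h') hCstab
  have h4 := mul_le_mul_of_nonneg_left hlt.le (mul_nonneg hCstab hCdrel)
  have hy' : y ≤ (κ + Cstab * Cdrel * τ) * e := by
    have : y - κ * e ≤ Cstab * Cdrel * (τ * e) := by
      rw [← mul_assoc] at h3
      linarith
    linarith
  have h5 := pow_le_pow_left₀ hy hy' 2
  have h6 := pow_lt_pow_left₀ hlt hx two_ne_zero
  have h7 := mul_le_mul_of_nonneg_right hτκ (sq_nonneg e)
  rw [mul_pow] at h5 h6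
  linarith

end IsAdaptive

/-- The admissible reduction factor in the optimality of Dörfler marking. -/
lemma exists_reduction_factor {Cstab Cdrel τ : ℝ} (hCstab : 0 < Cstab) (hCdrel : 0 < Cdrel)
    (h : τ ^ 2 < 1 / (1 + Cstab ^ 2 * Cdrel ^ 2)) :
    ∃ κ, 0 < κ ∧ τ ^ 2 + (κ + Cstab * Cdrel * τ) ^ 2 ≤ 1 := by
  rw [lt_div_iff₀ (by positivity)] at h
  -- This κ turns the required inequality into an equality; it is positive exactly because τ lies
  -- below the threshold.
  refine ⟨√(1 - τ ^ 2) - Cstab * Cdrel * τ, ?_, ?_⟩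
  · rw [sub_pos]
    refine Real.lt_sqrt_of_sq_lt ?_
    nlinarith
  · rw [sub_add_cancel, Real.sq_sqrt]
    · linarith
    · nlinarith [mul_nonneg (sq_nonneg τ) (by positivity : 0 ≤ Cstab ^ 2 * Cdrel ^ 2)]

end GOAFEM
-- The iterative solver on a fixed mesh
namespace GOAFEM

namespace IsSolverRun

variable {d : ℕ} {P : ModelProblem d} {X : Submodule ℝ P.V} {w' : P.V} {est : P.V → ℝ}
  {qctr lam : ℝ} {w : ℕ → P.V} {m K : ℕ∞} (S : IsSolverRun P X w' est qctr lam w m K)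

include S

lemma error_le (hq : 0 ≤ qctr) (k : ℕ) (hk : (k : ℕ∞) ≤ m) :
    P.enorm (w' - w k) ≤ qctr ^ k * P.enorm (w' - w 0) := by
  induction k with
  | zero => simp
  | succ k ih =>
    have h1 := S.contraction (k + 1) (by omega) hk
    have h2 := ih (le_trans (by exact_mod_cast Nat.le_succ k) hk)
    rw [Nat.add_sub_cancel] at h1
    rw [pow_succ', mul_assoc]
    exact h1.trans (mul_le_mul_of_nonneg_left h2 hq)

lemma enorm_increment_le (hq : 0 ≤ qctr) (hq₁ : qctr < 1) (k : ℕ)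
    (hk : ((k + 1 : ℕ) : ℕ∞) ≤ m) :
    P.enorm (w (k + 1) - w k) ≤ 2 * (qctr ^ k * P.enorm (w' - w 0)) := by
  have h1 := S.contraction (k + 1) (by omega) hk
  have h2 := S.error_le hq k (le_trans (by exact_mod_cast Nat.le_succ k) hk)
  have h3 := P.enorm_sub_le (w (k + 1)) w' (w k)
  rw [P.enorm_sub_comm (w (k + 1)) w'] at h3
  rw [Nat.add_sub_cancel] at h1
  have h4 : qctr * P.enorm (w' - w k) ≤ P.enorm (w' - w k) :=
    mul_le_of_le_one_left (P.enorm_nonneg _) hq₁.le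
  linarith

/-- The solver error of the final iterate is controlled by the estimator. -/
lemma final_error_le (hq : 0 ≤ qctr) {k : ℕ} (hk : m = k) :
    (1 - qctr) * P.enorm (w' - w k) ≤ qctr * lam * est (w k) := by
  have h1k : 1 ≤ k := by
    have := S.one_le
    rw [hk] at this
    exact_mod_cast this
  have h1 := S.contraction k h1k hk.ge
  have h2 := mul_le_mul_of_nonneg_left (S.stopping k hk) hq
  have h3 := mul_le_mul_of_nonneg_left (P.enorm_sub_le w' (w k) (w (k - 1))) hq
  linarith

/-- The index is j = min(k, m): beyond the stopping index the iterates are frozen. -/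
lemma exists_index (k : ℕ) (hk : (k : ℕ∞) ≤ K) :
    ∃ j : ℕ, (j : ℕ∞) ≤ m ∧ w k = w j ∧ ((k : ℕ∞) ≤ m → j = k) ∧
      (m ≤ k → m = j) := by
  rcases le_or_gt (k : ℕ∞) m with h | h
  · exact ⟨k, h, rfl, fun _ => rfl, fun h' => le_antisymm h' h⟩
  · lift m to ℕ using (ne_top_of_lt h)
    exact ⟨m, le_rfl, S.constant m k rfl (by exact_mod_cast h) hk,
      fun h' => absurd h (not_lt.2 h'), fun _ => rfl⟩

end IsSolverRun

/-- The constant in the contraction of the solver iterates on a fixed mesh. -/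
def solverConst (Cstab qctr lam : ℝ) : ℝ := (2 + 2 / (lam * qctr) + 2 * Cstab) / qctr

lemma one_le_solverConst {Cstab qctr lam : ℝ} (hC : 0 < Cstab) (hq : 0 < qctr) (hq₁ : qctr < 1)
    (hlam : 0 < lam) : 1 ≤ solverConst Cstab qctr lam := by
  rw [solverConst, le_div_iff₀ hq]
  have : 0 < 2 / (lam * qctr) := by positivity
  linarith

/-- Before the stopping index the criterion is violated, so the estimator is below 1/lam times the
increment, which decays like the solver error. The stopping index itself is reached from its
predecessor by stability; the lost step costs the factor 1/qctr in `solverConst`. -/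
lemma IsSolverRun.quasiError_le {d : ℕ} {P : ModelProblem d} {p : ℕ} {refine : Refinement d}
    {𝒯₀ : Mesh d} {μ : Indicators P} {v : P.V} {wD : Mesh d → P.V}
    {Cstab qred Crel Cdrel : ℝ} (H : IsAdaptive P p refine 𝒯₀ μ v wD Cstab qred Crel Cdrel)
    {𝒯 : Mesh d} (h𝒯 : 𝒯 ∈ refinements refine 𝒯₀) {qctr lam : ℝ} {w : ℕ → P.V} {m K : ℕ∞}
    (S : IsSolverRun P (P.X p 𝒯) (wD 𝒯) (fun v => total (μ 𝒯 v) 𝒯) qctr lam w m K)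
    (hC : 0 < Cstab) (hq : 0 < qctr) (hq₁ : qctr < 1) (hlam : 0 < lam) (k : ℕ)
    (hk : (k : ℕ∞) ≤ m) :
    P.enorm (wD 𝒯 - w k) + total (μ 𝒯 (w k)) 𝒯 ≤ solverConst Cstab qctr lam * qctr ^ k *
      (P.enorm (wD 𝒯 - w 0) + total (μ 𝒯 (w 0)) 𝒯) := by
  set e0 := P.enorm (wD 𝒯 - w 0) with he0
  set D0 := e0 + total (μ 𝒯 (w 0)) 𝒯 with hD0
  have he0n : 0 ≤ e0 := P.enorm_nonneg _
  have hle : e0 ≤ D0 := le_add_of_nonneg_right (total_nonneg _ _)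
  have hD0n : 0 ≤ D0 := he0n.trans hle
  set B := 2 / (lam * qctr) with hB
  have hBpos : 0 < B := by positivity
  have key : ∀ j : ℕ, (j : ℕ∞) < m →
      P.enorm (wD 𝒯 - w j) + total (μ 𝒯 (w j)) 𝒯 ≤ (1 + B) * (qctr ^ j * D0) := by
    intro j hj
    rcases j with _ | j
    · rw [pow_zero, one_mul, ← he0, ← hD0]
      nlinarith
    · have h1 := S.error_le hq.le (j + 1) hj.le
      have h2 := S.enorm_increment_le hq.le hq₁ j hj.le
      have h3 := S.not_earlier (j + 1) (by omega) hj
      rw [Nat.add_sub_cancel, not_le] at h3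
      have h4 : total (μ 𝒯 (w (j + 1))) 𝒯 ≤ B * (qctr ^ (j + 1) * e0) := by
        have h5 : B * (qctr ^ (j + 1) * e0) = 2 * (qctr ^ j * e0) / lam := by
          rw [hB, pow_succ]
          field_simp
        rw [h5, le_div_iff₀ hlam]
        linarith
      have h6 : qctr ^ (j + 1) * e0 ≤ qctr ^ (j + 1) * D0 := by gcongr
      have h7 := mul_le_mul_of_nonneg_left h6 hBpos.le
      linarith
  have hpow : ∀ j : ℕ, 0 ≤ qctr ^ j * D0 := fun j => by positivity
  rcases lt_or_eq_of_le hk with hlt | heq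
  · refine (key k hlt).trans ?_
    rw [mul_assoc]
    refine mul_le_mul_of_nonneg_right ?_ (hpow k)
    rw [solverConst, le_div_iff₀ hq]
    have : (1 + B) * qctr ≤ (1 + B) := mul_le_of_le_one_right (by positivity) hq₁.le
    linarith
  · obtain ⟨j, rfl⟩ : ∃ j, k = j + 1 := by
      have h1 := S.one_le
      rw [← heq] at h1
      exact ⟨k - 1, by have : 1 ≤ k := by exact_mod_cast h1
                       omega⟩
    have hj : (j : ℕ∞) < m := lt_of_lt_of_le (by exact_mod_cast Nat.lt_succ_self j) hk
    have h1 := key j hj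
    have h2 := S.error_le hq.le (j + 1) hk
    have h3 := S.enorm_increment_le hq.le hq₁ j hk
    have h4 := H.total_le_add_enorm h𝒯 (S.mem j hj.le) (S.mem (j + 1) hk) (subset_refl _)
    have h5 := mul_le_mul_of_nonneg_left h3 hC.le
    have h6 : qctr ^ (j + 1) * e0 ≤ qctr ^ j * D0 := by
      refine mul_le_mul (pow_le_pow_of_le_one hq.le hq₁.le (Nat.le_succ j)) hle he0n
        (by positivity)
    have h7 : qctr ^ j * e0 ≤ qctr ^ j * D0 := by gcongr
    have h8 := mul_le_mul_of_nonneg_left h7 hC.le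
    have h9 : solverConst Cstab qctr lam * qctr ^ (j + 1) * D0 =
        (2 + B + 2 * Cstab) * (qctr ^ j * D0) := by
      rw [solverConst, ← hB, pow_succ]
      field_simp
    have h10 := P.enorm_nonneg (wD 𝒯 - w j)
    rw [h9]
    linarith

end GOAFEM
-- Contraction of abstract error sequences and of their product
namespace GOAFEM

/-- Sequences of exact errors `E`, solver errors `e`, estimators `h` and distances `D` of discrete
solutions on the levels below `L`, linked by the axioms of adaptivity; the set `S` contains the
levels on which the estimator satisfies a Dörfler criterion. -/
structure IsErrorSystem (Cstab Crel q κ : ℝ) (L : ℕ∞) (S : Set ℕ) (E e h : ℕ → ℝ)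
    (D : ℕ → ℕ → ℝ) : Prop where
  E_nonneg : ∀ l, 0 ≤ E l
  e_nonneg : ∀ l, 0 ≤ e l
  h_nonneg : ∀ l, 0 ≤ h l
  D_nonneg : ∀ l l', 0 ≤ D l l'
  reliability : ∀ l : ℕ, (l : ℕ∞) < L → E l ≤ Crel * (h l + Cstab * e l)
  pythagoras : ∀ l l' : ℕ, l ≤ l' → (l' : ℕ∞) < L → E l ^ 2 = E l' ^ 2 + D l l' ^ 2
  solver : ∀ l : ℕ, ((l + 1 : ℕ) : ℕ∞) < L → e (l + 1) ≤ q * (e l + D l (l + 1))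
  estimator : ∀ l l' : ℕ, l < l' → (l' : ℕ∞) < L → ∃ x, 0 ≤ x ∧ x ^ 2 ≤ h l ^ 2 ∧
    (l ∈ S → x ^ 2 ≤ κ * h l ^ 2) ∧ h l' ≤ x + Cstab * (e l' + D l l' + e l)

/-- The quantity E² + (1 - q)e² does not increase from level to level, so iterating costs no
constant that grows with l' - l. Pythagoras then turns the drop of E² into D². -/
lemma IsErrorSystem.solver_error_le {Cstab Crel q κ : ℝ} {L : ℕ∞} {S : Set ℕ} {E e h : ℕ → ℝ}
    {D : ℕ → ℕ → ℝ} (H : IsErrorSystem Cstab Crel q κ L S E e h D) (hq : 0 < q) (hq₁ : q < 1)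
    {l l' : ℕ} (hl : l < l') (hl' : (l' : ℕ∞) < L) :
    (1 - q) * e l' ^ 2 ≤ D l l' ^ 2 + (1 - q) * q * e l ^ 2 := by
  have step : ∀ j : ℕ, ((j + 1 : ℕ) : ℕ∞) < L →
      E (j + 1) ^ 2 + (1 - q) * e (j + 1) ^ 2 ≤ E j ^ 2 + (1 - q) * q * e j ^ 2 := by
    intro j hj
    have h1 := pow_le_pow_left₀ (H.e_nonneg (j + 1)) (H.solver j hj) 2
    have h2 := H.pythagoras j (j + 1) (Nat.le_succ j) hj
    have h3 := mul_le_mul_of_nonneg_left h1 (sub_nonneg.2 hq₁.le)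
    -- This is the difference D² + (1 - q)qe² - (1 - q)q²(e + D)² after completing the square.
    have h4 : 0 ≤ q * ((1 - q) * e j - q * D j (j + 1)) ^ 2 + (1 - q ^ 2) * D j (j + 1) ^ 2 :=
      add_nonneg (by positivity) (mul_nonneg (by nlinarith) (sq_nonneg _))
    nlinarith
  have main : E l' ^ 2 + (1 - q) * e l' ^ 2 ≤ E l ^ 2 + (1 - q) * q * e l ^ 2 := by
    induction l', hl using Nat.le_induction with
    | base => exact step l hl'
    | succ j hj ih =>
      have h1 := ih (lt_of_le_of_lt (by exact_mod_cast Nat.le_succ j) hl')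
      have h2 := step j hl'
      have h3 : 0 ≤ (1 - q) * ((1 - q) * e j ^ 2) :=
        mul_nonneg (by linarith) (mul_nonneg (by linarith) (sq_nonneg _))
      nlinarith
  have := H.pythagoras l l' hl.le hl'
  linarith

/-- One step of the contraction argument for the weighted quasi-error. -/
lemma weighted_quasiError_step {q δ γ C E e E' e' h' D x : ℝ} (hq : 0 < q) (hq₁ : q < 1)
    (hδ : 0 < δ) (hγ₀ : 0 < γ) (hγ : γ * ((1 + 1 / δ) * C ^ 2 * (6 / (1 - q))) = (1 - q) ^ 2 / 4)
    (hh' : 0 ≤ h') (hE : E ^ 2 = E' ^ 2 + D ^ 2)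
    (hsolve : (1 - q) * e' ^ 2 ≤ D ^ 2 + (1 - q) * q * e ^ 2)
    (hest : h' ≤ x + C * (e' + D + e)) :
    E' ^ 2 + (1 - q) / 2 * e' ^ 2 + γ * h' ^ 2 ≤
      E ^ 2 + (1 - q) / 2 * ((1 + q) / 2) * e ^ 2 + γ * (1 + δ) * x ^ 2 := by
  have hq' : 0 < 1 - q := by linarith
  have h1 : h' ^ 2 ≤ (1 + δ) * x ^ 2 + (1 + 1 / δ) * (C ^ 2 * (e' + D + e) ^ 2) := by
    refine (pow_le_pow_left₀ hh' hest 2).trans ?_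
    -- Young's inequality with parameter δ.
    have : 0 ≤ (δ * x - C * (e' + D + e)) ^ 2 / δ := by positivity
    have h2 : (1 + δ) * x ^ 2 + (1 + 1 / δ) * (C ^ 2 * (e' + D + e) ^ 2) -
        (x + C * (e' + D + e)) ^ 2 = (δ * x - C * (e' + D + e)) ^ 2 / δ := by
      field_simp
      ring
    linarith
  have h2 : (e' + D + e) ^ 2 ≤ 6 / (1 - q) * (D ^ 2 + e ^ 2) := by
    have h3 : (e' + D + e) ^ 2 ≤ 3 * (e' ^ 2 + D ^ 2 + e ^ 2) := by
      nlinarith [sq_nonneg (e' - D), sq_nonneg (e' - e), sq_nonneg (D - e)]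
    rw [div_mul_eq_mul_div, le_div_iff₀ hq']
    have h4 := mul_le_mul_of_nonneg_right h3 hq'.le
    have h5 : 0 ≤ q * D ^ 2 := by positivity
    have h6 : 0 ≤ (1 + q * q) * e ^ 2 := by positivity
    nlinarith
  have h3 : γ * ((1 + 1 / δ) * (C ^ 2 * (e' + D + e) ^ 2)) ≤ (1 - q) ^ 2 / 4 * (D ^ 2 + e ^ 2) := by
    rw [← hγ]
    have : 0 ≤ γ * ((1 + 1 / δ) * C ^ 2) := by positivity
    have := mul_le_mul_of_nonneg_left h2 this
    linarith
  -- Half of the D² gained by Pythagoras pays for the solver error e', the other half absorbs the D²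
  -- that comes with the estimator. The value of γ makes the coefficients of e² add up to the weight
  -- (1 - q)/2 times (1 + q)/2 < 1.
  have h4 := mul_le_mul_of_nonneg_left h1 hγ₀.le
  have h5 : (1 - q) ^ 2 / 4 * D ^ 2 ≤ 1 / 2 * D ^ 2 :=
    mul_le_mul_of_nonneg_right (by nlinarith) (sq_nonneg _)
  linarith

/-- The weighted quasi-error contracts from each level of `S` to all later levels, and it is
quasi-monotone in general. -/
lemma exists_weights {Cstab Crel q κ : ℝ} (hC : 0 < Cstab) (hCrel : 0 < Crel)
    (hq : 0 < q) (hq₁ : q < 1) (hκ : 0 ≤ κ) (hκ₁ : κ < 1) :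
    ∃ ν γ ρ : ℝ, 0 < ν ∧ 0 < γ ∧ 0 < ρ ∧ ρ < 1 ∧
      ∀ (L : ℕ∞) (S : Set ℕ) (E e h : ℕ → ℝ) (D : ℕ → ℕ → ℝ),
        IsErrorSystem Cstab Crel q κ L S E e h D → ∀ l l' : ℕ, l < l' → (l' : ℕ∞) < L →
          E l' ^ 2 + ν * e l' ^ 2 + γ * h l' ^ 2 ≤
            2 * (E l ^ 2 + ν * e l ^ 2 + γ * h l ^ 2) ∧
          (l ∈ S → E l' ^ 2 + ν * e l' ^ 2 + γ * h l' ^ 2 ≤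
            ρ * (E l ^ 2 + ν * e l ^ 2 + γ * h l ^ 2)) := by
  have hq' : 0 < 1 - q := by linarith
  -- Small enough that (1 + δ)κ ≤ (1 + κ)/2 < 1, so Young's inequality does not use up the Dörfler
  -- reduction.
  set δ := (1 - κ) / 2 with hδ
  have hδ₀ : 0 < δ := by rw [hδ]; linarith
  set γ := (1 - q) ^ 2 / 4 / ((1 + 1 / δ) * Cstab ^ 2 * (6 / (1 - q))) with hγ
  have hden : 0 < (1 + 1 / δ) * Cstab ^ 2 * (6 / (1 - q)) := by positivity
  have hγ₀ : 0 < γ := by positivity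
  have hγeq : γ * ((1 + 1 / δ) * Cstab ^ 2 * (6 / (1 - q))) = (1 - q) ^ 2 / 4 :=
    div_mul_cancel₀ _ hden.ne'
  set ν := (1 - q) / 2 with hν
  have hν₀ : 0 < ν := by positivity
  -- The terms νe² and γh² leave gains of ν(1 - q)/2·e² and γ(1 - κ)/2·h². Reliability bounds E² by
  -- e² and h², so the gains absorb ε times the full weighted quasi-error if ε is below both
  -- quotients.
  set ε := min (ν * (1 - q) / 2 / (2 * Crel ^ 2 * Cstab ^ 2 + ν))
    (γ * (1 - κ) / 2 / (2 * Crel ^ 2 + γ)) with hε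
  have hε₀ : 0 < ε := by
    have : 0 < 1 - κ := by linarith
    exact lt_min (by positivity) (by positivity)
  have hε₁ : ε * (2 * Crel ^ 2 * Cstab ^ 2 + ν) ≤ ν * (1 - q) / 2 := by
    rw [← le_div_iff₀ (by positivity)]
    exact min_le_left _ _
  have hε₂ : ε * (2 * Crel ^ 2 + γ) ≤ γ * (1 - κ) / 2 := by
    rw [← le_div_iff₀ (by positivity)]
    exact min_le_right _ _
  have hε_lt : ε < 1 := by
    by_contra! hge
    have h1 : (2 * Crel ^ 2 * Cstab ^ 2 + ν) ≤ ε * (2 * Crel ^ 2 * Cstab ^ 2 + ν) :=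
      le_mul_of_one_le_left (by positivity) hge
    have h2 : 0 ≤ 2 * Crel ^ 2 * Cstab ^ 2 := by positivity
    nlinarith
  have hκδ : (1 + δ) * κ ≤ (1 + κ) / 2 := by
    rw [hδ]
    nlinarith
  refine ⟨ν, γ, 1 - ε, hν₀, hγ₀, by linarith, by linarith, ?_⟩
  intro L S E e h D H l l' hl hl'
  obtain ⟨x, hx₀, hx, hxS, hest⟩ := H.estimator l l' hl hl'
  have key := weighted_quasiError_step hq hq₁ hδ₀ hγ₀ hγeq (H.h_nonneg l')
    (H.pythagoras l l' hl.le hl') (H.solver_error_le hq hq₁ hl hl') hest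
  rw [← hν] at key
  have hle : ν * ((1 + q) / 2) * e l ^ 2 ≤ ν * e l ^ 2 :=
    mul_le_mul_of_nonneg_right (mul_le_of_le_one_right hν₀.le (by linarith)) (sq_nonneg _)
  refine ⟨?_, fun hS => ?_⟩
  · have h1 : γ * (1 + δ) * x ^ 2 ≤ γ * 2 * h l ^ 2 := by
      refine mul_le_mul ?_ hx (sq_nonneg _) (by positivity)
      exact mul_le_mul_of_nonneg_left (by rw [hδ]; linarith) hγ₀.le
    have h2 : 0 ≤ E l ^ 2 := sq_nonneg _
    have h3 : 0 ≤ ν * e l ^ 2 := by positivity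
    linarith
  · have h1 : γ * (1 + δ) * x ^ 2 ≤ γ * ((1 + κ) / 2) * h l ^ 2 := by
      have h2 := mul_le_mul_of_nonneg_left (hxS hS) (by positivity : 0 ≤ γ * (1 + δ))
      have h3 := mul_le_mul_of_nonneg_right hκδ (by positivity : 0 ≤ γ * h l ^ 2)
      linarith
    have h2 : E l ^ 2 ≤ 2 * Crel ^ 2 * (h l ^ 2 + Cstab ^ 2 * e l ^ 2) := by
      have h3 := pow_le_pow_left₀ (H.E_nonneg l)
        (H.reliability l (lt_of_le_of_lt (by exact_mod_cast hl.le) hl')) 2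
      have h4 : 0 ≤ Crel ^ 2 * (h l - Cstab * e l) ^ 2 := by positivity
      linarith
    have h3 := mul_le_mul_of_nonneg_left h2 hε₀.le
    have h4 := mul_le_mul_of_nonneg_right hε₁ (sq_nonneg (e l))
    have h5 := mul_le_mul_of_nonneg_right hε₂ (sq_nonneg (h l))
    linarith

/-- The weighted quasi-error is essentially contractive on the levels of `S` and never increases
essentially; passing to the supremum over all later levels gives a quantity that is truly
monotone. -/
lemma exists_contraction_factor {Cstab Crel q κ : ℝ} (hC : 0 < Cstab) (hCrel : 0 < Crel)
    (hq : 0 < q) (hq₁ : q < 1) (hκ : 0 ≤ κ) (hκ₁ : κ < 1) :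
    ∃ ρ C : ℝ, 0 < ρ ∧ ρ < 1 ∧ 0 < C ∧
      ∀ (L : ℕ∞) (S : Set ℕ) (E e h : ℕ → ℝ) (D : ℕ → ℕ → ℝ),
        IsErrorSystem Cstab Crel q κ L S E e h D → ∃ V : ℕ → ℝ, ∀ l : ℕ, (l : ℕ∞) < L →
          (e l + h l) ^ 2 ≤ C * V l ∧ V l ≤ C * (e l + h l) ^ 2 ∧ 0 ≤ V (l + 1) ∧
          V (l + 1) ≤ V l ∧ (l ∈ S → V (l + 1) ≤ ρ * V l) := by
  obtain ⟨ν, γ, ρ, hν₀, hγ₀, hρ₀, hρ₁, hstep⟩ := exists_weights hC hCrel hq hq₁ hκ hκ₁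
  refine ⟨ρ, 2 / ν + 2 / γ + 2 * (2 * Crel ^ 2 * (1 + Cstab ^ 2) + ν + γ), hρ₀, hρ₁,
    by positivity, ?_⟩
  intro L S E e h D H
  replace hstep := hstep L S E e h D H
  set W : ℕ → ℝ := fun l => E l ^ 2 + ν * e l ^ 2 + γ * h l ^ 2 with hW
  have hW₀ : ∀ l, 0 ≤ W l := fun l => by positivity
  -- The contraction from a level of S holds towards all later levels, so it passes to this
  -- supremum. On the last level below a finite L, the set for l + 1 is empty and `sSup ∅ = 0`; the
  -- claims about V (l + 1) therefore need no level l + 1.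
  set V : ℕ → ℝ := fun l => sSup (W '' {j | l ≤ j ∧ (j : ℕ∞) < L}) with hV
  have hup : ∀ l j : ℕ, (l ≤ j ∧ (j : ℕ∞) < L) → W j ≤ 2 * W l := by
    rintro l j ⟨hlj, hj⟩
    rcases hlj.eq_or_lt with rfl | hlt
    · linarith [hW₀ l]
    · exact (hstep l j hlt hj).1
  have hbdd : ∀ l, BddAbove (W '' {j | l ≤ j ∧ (j : ℕ∞) < L}) := by
    rintro l
    refine ⟨2 * W l, ?_⟩
    rintro _ ⟨j, hj, rfl⟩
    exact hup l j hj
  have hle_V : ∀ l j : ℕ, l ≤ j → (j : ℕ∞) < L → W j ≤ V l := fun l j hlj hj =>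
    le_csSup (hbdd l) ⟨j, ⟨hlj, hj⟩, rfl⟩
  have hV_le : ∀ (l : ℕ) (B : ℝ), 0 ≤ B → (∀ j : ℕ, l ≤ j → (j : ℕ∞) < L → W j ≤ B) →
      V l ≤ B := by
    intro l B hB hj
    refine Real.sSup_le ?_ hB
    rintro _ ⟨j, ⟨h1, h2⟩, rfl⟩
    exact hj j h1 h2
  have hV₀ : ∀ l, 0 ≤ V l := fun l => Real.sSup_nonneg (by rintro _ ⟨j, -, rfl⟩; exact hW₀ j)
  refine ⟨V, fun l hl => ⟨?_, ?_, hV₀ _, ?_, fun hS => ?_⟩⟩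
  · have h1 : (2 / ν + 2 / γ) * W l ≤
        (2 / ν + 2 / γ + 2 * (2 * Crel ^ 2 * (1 + Cstab ^ 2) + ν + γ)) * V l :=
      mul_le_mul (le_add_of_nonneg_right (by positivity)) (hle_V l l le_rfl hl) (hW₀ l)
        (by positivity)
    refine le_trans ?_ h1
    have h2 : (2 / ν + 2 / γ) * W l = 2 * e l ^ 2 + 2 * h l ^ 2 + (2 / ν + 2 / γ) * E l ^ 2 +
        2 / ν * (γ * h l ^ 2) + 2 / γ * (ν * e l ^ 2) := by
      simp only [hW]
      field_simp
      ring
    have h3 : 0 ≤ (2 / ν + 2 / γ) * E l ^ 2 + 2 / ν * (γ * h l ^ 2) + 2 / γ * (ν * e l ^ 2) := by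
      positivity
    nlinarith [sq_nonneg (e l - h l)]
  · have he := H.e_nonneg l
    have hh := H.h_nonneg l
    have h1 : V l ≤ 2 * W l := hV_le l _ (by linarith [hW₀ l]) fun j h1 h2 => hup l j ⟨h1, h2⟩
    have h3 := pow_le_pow_left₀ (H.E_nonneg l) (H.reliability l hl) 2
    have h4 : 0 ≤ Crel ^ 2 * (h l - Cstab * e l) ^ 2 := by positivity
    have h5 : e l ^ 2 ≤ (e l + h l) ^ 2 := by nlinarith
    have h6 : h l ^ 2 ≤ (e l + h l) ^ 2 := by nlinarith
    have h7 : W l ≤ (2 * Crel ^ 2 * (1 + Cstab ^ 2) + ν + γ) * (e l + h l) ^ 2 := by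
      have h8 := mul_le_mul_of_nonneg_left h5 (by positivity : 0 ≤ 2 * Crel ^ 2 * Cstab ^ 2 + ν)
      have h9 := mul_le_mul_of_nonneg_left h6 (by positivity : 0 ≤ 2 * Crel ^ 2 + γ)
      simp only [hW]
      linarith
    have h8 : 0 ≤ (2 / ν + 2 / γ) * (e l + h l) ^ 2 := by positivity
    linarith
  · exact hV_le _ _ (hV₀ l) fun j h1 h2 => hle_V l j (by omega) h2
  · exact hV_le _ _ (mul_nonneg hρ₀.le (hV₀ l)) fun j h1 h2 =>
      ((hstep l j h1 h2).2 hS).trans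
        (mul_le_mul_of_nonneg_left (hle_V l l le_rfl hl) hρ₀.le)

/-- If on each level one of two error systems satisfies the Dörfler criterion, then the product of
the quasi-errors converges linearly. -/
lemma exists_product_contraction {Cstab Crel q κ : ℝ} (hC : 0 < Cstab) (hCrel : 0 < Crel)
    (hq : 0 < q) (hq₁ : q < 1) (hκ : 0 ≤ κ) (hκ₁ : κ < 1) :
    ∃ ρ C : ℝ, 0 < ρ ∧ ρ < 1 ∧ 0 < C ∧
      ∀ (L : ℕ∞) (S S' : Set ℕ) (E e h E' e' h' : ℕ → ℝ) (D D' : ℕ → ℕ → ℝ),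
        IsErrorSystem Cstab Crel q κ L S E e h D →
        IsErrorSystem Cstab Crel q κ L S' E' e' h' D' →
        (∀ l : ℕ, (l : ℕ∞) < L → l ∈ S ∨ l ∈ S') →
        ∀ l n : ℕ, ((l + n : ℕ) : ℕ∞) < L →
          (e (l + n) + h (l + n)) * (e' (l + n) + h' (l + n)) ≤
            C * ρ ^ n * ((e l + h l) * (e' l + h' l)) := by
  obtain ⟨ρ, C, hρ₀, hρ₁, hC₀, main⟩ := exists_contraction_factor hC hCrel hq hq₁ hκ hκ₁
  -- V and V' are comparable to squares of quasi-errors, hence the square root of the rate.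
  refine ⟨√ρ, C ^ 2, Real.sqrt_pos.2 hρ₀, by rwa [Real.sqrt_lt' one_pos, one_pow],
    by positivity, ?_⟩
  intro L S S' E e h E' e' h' D D' H H' hS l n hln
  obtain ⟨V, hV⟩ := main L S E e h D H
  obtain ⟨V', hV'⟩ := main L S' E' e' h' D' H'
  have hlt : ∀ j : ℕ, j ≤ n → ((l + j : ℕ) : ℕ∞) < L := fun j hj =>
    lt_of_le_of_lt (by exact_mod_cast (by omega : l + j ≤ l + n)) hln
  have nonneg : ∀ {j : ℕ}, j ≤ n → 0 ≤ V (l + j) ∧ 0 ≤ V' (l + j) := by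
    intro j hj
    have h1 := (hV _ (hlt j hj)).1
    have h2 := (hV' _ (hlt j hj)).1
    exact ⟨nonneg_of_mul_nonneg_right ((sq_nonneg _).trans h1) hC₀,
      nonneg_of_mul_nonneg_right ((sq_nonneg _).trans h2) hC₀⟩
  have hprod : ∀ j : ℕ, j ≤ n → V (l + j) * V' (l + j) ≤ ρ ^ j * (V l * V' l) := by
    intro j
    induction j with
    | zero => simp
    | succ j ih =>
      intro hj
      have h1 := ih (by omega)
      obtain ⟨-, -, p1, m1, c1⟩ := hV _ (hlt j (by omega))
      obtain ⟨-, -, p2, m2, c2⟩ := hV' _ (hlt j (by omega))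
      obtain ⟨n1, n2⟩ := nonneg (by omega : j ≤ n)
      -- One factor contracts; the other does not increase, with constant exactly one.
      have h2 : V (l + j + 1) * V' (l + j + 1) ≤ ρ * (V (l + j) * V' (l + j)) := by
        rcases hS _ (hlt j (by omega)) with hs | hs
        · rw [← mul_assoc]
          exact mul_le_mul (c1 hs) m2 p2 (by positivity)
        · rw [mul_left_comm]
          exact mul_le_mul m1 (c2 hs) p2 n1
      rw [pow_succ', mul_assoc]
      exact h2.trans (mul_le_mul_of_nonneg_left h1 hρ₀.le)
  have he := H.e_nonneg
  have hh := H.h_nonneg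
  have he' := H'.e_nonneg
  have hh' := H'.h_nonneg
  refine (abs_le_of_sq_le_sq' ?_ ?_).2
  · have h1 := (hV _ (hlt n le_rfl)).1
    have h2 := (hV' _ (hlt n le_rfl)).1
    have h3 := (hV _ (hlt 0 (by omega))).2.1
    have h4 := (hV' _ (hlt 0 (by omega))).2.1
    rw [add_zero] at h3 h4
    have n1 := nonneg (le_refl n)
    have n2 := nonneg (Nat.zero_le n)
    rw [add_zero] at n2
    have h5 := mul_le_mul h1 h2 (sq_nonneg _) (mul_nonneg hC₀.le n1.1)
    have h6 := mul_le_mul h3 h4 n2.2 (by positivity)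
    have h7 : (√ρ ^ n) ^ 2 = ρ ^ n := by
      rw [← pow_mul, mul_comm, pow_mul, Real.sq_sqrt hρ₀.le]
    have h8 := mul_le_mul_of_nonneg_left (hprod n le_rfl) (by positivity : 0 ≤ C * C)
    have h9 := mul_le_mul_of_nonneg_left h6 (by positivity : 0 ≤ C * C * ρ ^ n)
    calc ((e (l + n) + h (l + n)) * (e' (l + n) + h' (l + n))) ^ 2
        = (e (l + n) + h (l + n)) ^ 2 * (e' (l + n) + h' (l + n)) ^ 2 := by ring
      _ ≤ C * C * (V (l + n) * V' (l + n)) := by linarith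
      _ ≤ C * C * ρ ^ n * (V l * V' l) := by linarith
      _ ≤ C * C * ρ ^ n * (C * (e l + h l) ^ 2 * (C * (e' l + h' l) ^ 2)) := h9
      _ = (C ^ 2 * √ρ ^ n * ((e l + h l) * (e' l + h' l))) ^ 2 := by
        rw [mul_pow, mul_pow, h7]
        ring
  · have := he l
    have := hh l
    have := he' l
    have := hh' l
    positivity

end GOAFEM
-- Linear convergence of the adaptive algorithm
namespace GOAFEM

lemma natCast_succ_le {l : ℕ} {L : ℕ∞} (h : (l : ℕ∞) < L) : ((l + 1 : ℕ) : ℕ∞) ≤ L := by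
  exact_mod_cast Order.add_one_le_of_lt h

/-- A sequence of meshes generated by refinement on all levels below `L`. -/
structure IsMeshSequence {d : ℕ} (refine : Refinement d) (𝒯₀ : Mesh d) (mesh marked : ℕ → Mesh d)
    (L : ℕ∞) : Prop where
  zero : mesh 0 = 𝒯₀
  marked_subset : ∀ l : ℕ, (l : ℕ∞) < L → marked l ⊆ mesh l
  succ : ∀ l : ℕ, (l : ℕ∞) < L → mesh (l + 1) = refine (mesh l) (marked l)

namespace IsMeshSequence

variable {d : ℕ} {refine : Refinement d} {𝒯₀ : Mesh d} {mesh marked : ℕ → Mesh d} {L : ℕ∞}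
  (M : IsMeshSequence refine 𝒯₀ mesh marked L)

include M

lemma succ_mem {l : ℕ} (hl : (l : ℕ∞) < L) : mesh (l + 1) ∈ refinements refine (mesh l) := by
  rw [M.succ l hl]
  exact refine_mem_refinements (M.marked_subset l hl)

lemma mem_of_le {l l' : ℕ} (h : l ≤ l') (hl' : (l' : ℕ∞) ≤ L) :
    mesh l' ∈ refinements refine (mesh l) := by
  induction l', h using Nat.le_induction with
  | base => exact self_mem_refinements _
  | succ j hj ih =>
    have hlt : (j : ℕ∞) < L := lt_of_lt_of_le (by exact_mod_cast Nat.lt_succ_self j) hl'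
    exact refinements_trans (ih hlt.le) (M.succ_mem hlt)

lemma mem {l : ℕ} (hl : (l : ℕ∞) ≤ L) : mesh l ∈ refinements refine 𝒯₀ := by
  have := M.mem_of_le (Nat.zero_le l) hl
  rwa [M.zero] at this

lemma card_le {Ccls : ℝ} (hcls : ClosureEstimate refine 𝒯₀ Ccls) {l : ℕ} (hl : (l : ℕ∞) ≤ L) :
    ((mesh l).card : ℝ) ≤ 𝒯₀.card + Ccls * ∑ j ∈ Finset.range l, ((marked j).card : ℝ) := by
  have := hcls mesh marked M.zero l fun j hj => by
    have hjl : (j : ℕ∞) < L := lt_of_lt_of_le (by exact_mod_cast hj) hl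
    exact ⟨M.marked_subset j hjl, M.succ j hjl⟩
  linarith

end IsMeshSequence

/-- The final iterates of a nested solver on a sequence of meshes form an error system. -/
lemma IsAdaptive.isErrorSystem {d : ℕ} {P : ModelProblem d} {p : ℕ} {refine : Refinement d}
    {𝒯₀ : Mesh d} {μ : Indicators P} {w : P.V} {wD : Mesh d → P.V}
    {Cstab qred Crel Cdrel q θ : ℝ} (H : IsAdaptive P p refine 𝒯₀ μ w wD Cstab qred Crel Cdrel)
    (hR : IsRefinementStrategy P.Ω refine 𝒯₀) (hC : 0 ≤ Cstab) (hCrel : 0 ≤ Crel)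
    (hqred : 0 ≤ qred) (hqred₁ : qred < 1)
    {mesh marked : ℕ → Mesh d} {L : ℕ∞} (M : IsMeshSequence refine 𝒯₀ mesh marked L)
    {wF : ℕ → P.V} (hF : ∀ l : ℕ, (l : ℕ∞) < L → wF l ∈ P.X p (mesh l))
    (hsolve : ∀ l : ℕ, ((l + 1 : ℕ) : ℕ∞) < L → P.enorm (wD (mesh (l + 1)) - wF (l + 1)) ≤
      q * P.enorm (wD (mesh (l + 1)) - wF l)) (hq : 0 ≤ q) :
    IsErrorSystem Cstab Crel q (1 - (1 - qred ^ 2) * θ) L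
      {l | θ * total (μ (mesh l) (wF l)) (mesh l) ^ 2 ≤ total (μ (mesh l) (wF l)) (marked l) ^ 2}
      (fun l => P.enorm (w - wD (mesh l))) (fun l => P.enorm (wD (mesh l) - wF l))
      (fun l => total (μ (mesh l) (wF l)) (mesh l))
      (fun l l' => P.enorm (wD (mesh l') - wD (mesh l))) where
  E_nonneg _ := P.enorm_nonneg _
  e_nonneg _ := P.enorm_nonneg _
  h_nonneg _ := total_nonneg _ _
  D_nonneg _ _ := P.enorm_nonneg _
  reliability l hl := by
    have hm := M.mem hl.le
    refine (H.reliability _ hm).trans (mul_le_mul_of_nonneg_left ?_ hCrel)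
    exact H.total_le_add_enorm hm (hF l hl) (H.mem _ hm) (subset_refl _)
  pythagoras l l' hll' hl' :=
    H.pythagoras _ (M.mem (le_trans (by exact_mod_cast hll') hl'.le)) _ (M.mem_of_le hll' hl'.le)
  solver l hl := by
    refine (hsolve l hl).trans (mul_le_mul_of_nonneg_left ?_ hq)
    have := P.enorm_sub_le (wD (mesh (l + 1))) (wD (mesh l)) (wF l)
    linarith
  estimator l l' hll' hl' := by
    have hl : (l : ℕ∞) < L := lt_trans (by exact_mod_cast hll') hl'
    have hm := M.mem hl.le
    have hm1 := M.mem (natCast_succ_le hl)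
    have hm' := M.mem hl'.le
    have hsucc := M.succ_mem hl
    have hl1 := M.mem_of_le (Nat.succ_le_of_lt hll') hl'.le
    have hv := hF l hl
    have hv1 := H.X_mono _ hm _ hsucc hv
    have hv' := H.X_mono _ hm1 _ hl1 hv1
    have h1 := H.total_refinement_le hqred hqred₁ hm1 hl1 hv1
    have h2 := pow_le_pow_left₀ (total_nonneg _ _) h1 2
    have h3 := H.total_sq_refinement_le hm hsucc hv
    have hqq : 0 ≤ 1 - qred ^ 2 := by nlinarith
    -- The witness is the estimator of the old iterate on the later mesh. The first refinement
    -- reduces it if marking was of Dörfler type, later refinements do not increase it, and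
    -- stability exchanges the old iterate for the new one.
    refine ⟨total (μ (mesh l') (wF l)) (mesh l'), total_nonneg _ _, ?_, fun hS => ?_, ?_⟩
    · have := mul_nonneg hqq (sq_nonneg (total (μ (mesh l) (wF l)) (mesh l \ mesh (l + 1))))
      exact h2.trans (by linarith)
    · have hsub : marked l ⊆ mesh l \ mesh (l + 1) := by
        rw [M.succ l hl]
        exact hR.marked_refined _ hm _ (M.marked_subset l hl)
      have h4 := pow_le_pow_left₀ (total_nonneg _ _) (total_mono (μ (mesh l) (wF l)) hsub) 2
      have h5 := mul_le_mul_of_nonneg_left (le_trans hS h4) hqq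
      refine h2.trans (h3.trans ?_)
      linarith
    · have h4 := H.total_le_add_enorm hm' hv' (hF l' hl') (subset_refl _)
      have h5 := P.enorm_sub_le (wF l') (wD (mesh l')) (wF l)
      have h6 := P.enorm_sub_le (wD (mesh l')) (wD (mesh l)) (wF l)
      rw [P.enorm_sub_comm (wF l') (wD (mesh l'))] at h5
      refine h4.trans (add_le_add_right (mul_le_mul_of_nonneg_left ?_ hC) _)
      linarith

/-- Passing to a refined mesh increases the quasi-error of a fixed function by at most a constant
factor. -/
lemma IsAdaptive.quasiError_refinement_le {d : ℕ} {P : ModelProblem d} {p : ℕ}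
    {refine : Refinement d} {𝒯₀ : Mesh d} {μ : Indicators P} {w : P.V} {wD : Mesh d → P.V}
    {Cstab qred Crel Cdrel : ℝ} (H : IsAdaptive P p refine 𝒯₀ μ w wD Cstab qred Crel Cdrel)
    (hC : 0 ≤ Cstab) (hCdrel : 0 ≤ Cdrel) (hqred : 0 ≤ qred) (hqred₁ : qred < 1)
    {𝒯 𝒯' : Mesh d} (h : 𝒯 ∈ refinements refine 𝒯₀) (h' : 𝒯' ∈ refinements refine 𝒯) {v : P.V}
    (hv : v ∈ P.X p 𝒯) :
    P.enorm (wD 𝒯' - v) + total (μ 𝒯' v) 𝒯' ≤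
      (1 + Cdrel * (1 + Cstab)) * (P.enorm (wD 𝒯 - v) + total (μ 𝒯 v) 𝒯) := by
  have h1 := P.enorm_sub_le (wD 𝒯') (wD 𝒯) v
  have h2 := (H.discreteReliability 𝒯 h 𝒯' h').trans
    (mul_le_mul_of_nonneg_left (total_mono _ Finset.sdiff_subset) hCdrel)
  have h3 := mul_le_mul_of_nonneg_left
    (H.total_le_add_enorm h hv (H.mem 𝒯 h) (subset_refl _)) hCdrel
  have h4 := H.total_refinement_le hqred hqred₁ h h' hv
  have h5 : 0 ≤ Cdrel * P.enorm (wD 𝒯 - v) := mul_nonneg hCdrel (P.enorm_nonneg _)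
  have h6 : 0 ≤ Cdrel * (Cstab * total (μ 𝒯 v) 𝒯) :=
    mul_nonneg hCdrel (mul_nonneg hC (total_nonneg _ _))
  linarith

lemma Iteration.Lam_nonneg {d : ℕ} {P : ModelProblem d} (I : Iteration P) (η ζ : Indicators P)
    (uD zD : Mesh d → P.V) (q : ℕ × ℕ) : 0 ≤ I.Lam η ζ uD zD q :=
  mul_nonneg (add_nonneg (P.enorm_nonneg _) (total_nonneg _ _))
    (add_nonneg (P.enorm_nonneg _) (total_nonneg _ _))

namespace Iteration.IsOutput

variable {d : ℕ} {P : ModelProblem d} {I : Iteration P} {p : ℕ} {refine : Refinement d}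
  {𝒯₀ : Mesh d} {η ζ : Indicators P} {u z : P.V} {uD zD : Mesh d → P.V}
  {Cstab qred Crel Cdrel qctr θ lam : ℝ}
  (O : I.IsOutput p refine 𝒯₀ η ζ uD zD qctr θ lam)

include O

lemma isMeshSequence : IsMeshSequence refine 𝒯₀ I.mesh I.marked I.last where
  zero := O.mesh_zero
  marked_subset l hl := (O.marking l hl).1
  succ l hl := O.refinement l hl

lemma m_ne_top {l : ℕ} (hl : (l : ℕ∞) < I.last) : I.m l ≠ ⊤ :=
  ne_top_of_le_ne_top (O.proceed l hl).1 (le_max_left _ _)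

lemma n_ne_top {l : ℕ} (hl : (l : ℕ∞) < I.last) : I.n l ≠ ⊤ :=
  ne_top_of_le_ne_top (O.proceed l hl).1 (le_max_right _ _)

lemma coe_m_toNat {l : ℕ} (hl : (l : ℕ∞) < I.last) : ((I.m l).toNat : ℕ∞) = I.m l :=
  ENat.natCast_toNat (O.m_ne_top hl)

lemma coe_n_toNat {l : ℕ} (hl : (l : ℕ∞) < I.last) : ((I.n l).toNat : ℕ∞) = I.n l :=
  ENat.natCast_toNat (O.n_ne_top hl)

lemma coe_kmax_toNat {l : ℕ} (hl : (l : ℕ∞) < I.last) : ((I.kmax l).toNat : ℕ∞) = I.kmax l :=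
  ENat.natCast_toNat (O.proceed l hl).1

lemma u_kmax {l : ℕ} (hl : (l : ℕ∞) < I.last) : I.u l (I.kmax l).toNat = I.uFinal l := by
  obtain ⟨j, -, hw, -, h⟩ := (O.primal_solver l hl.le).exists_index _ (O.coe_kmax_toNat hl).le
  rw [O.coe_kmax_toNat hl] at h
  rw [hw, uFinal, h (le_max_left _ _), ENat.toNat_natCast]

lemma z_kmax {l : ℕ} (hl : (l : ℕ∞) < I.last) : I.z l (I.kmax l).toNat = I.zFinal l := by
  obtain ⟨j, -, hw, -, h⟩ := (O.dual_solver l hl.le).exists_index _ (O.coe_kmax_toNat hl).le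
  rw [O.coe_kmax_toNat hl] at h
  rw [hw, zFinal, h (le_max_right _ _), ENat.toNat_natCast]

lemma uFinal_mem {l : ℕ} (hl : (l : ℕ∞) < I.last) : I.uFinal l ∈ P.X p (I.mesh l) :=
  (O.primal_solver l hl.le).mem _ (O.coe_m_toNat hl).le

lemma zFinal_mem {l : ℕ} (hl : (l : ℕ∞) < I.last) : I.zFinal l ∈ P.X p (I.mesh l) :=
  (O.dual_solver l hl.le).mem _ (O.coe_n_toNat hl).le

lemma Lam_kmax {l : ℕ} (hl : (l : ℕ∞) < I.last) : I.Lam η ζ uD zD (l, (I.kmax l).toNat) =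
    (P.enorm (uD (I.mesh l) - I.uFinal l) + total (η (I.mesh l) (I.uFinal l)) (I.mesh l)) *
    (P.enorm (zD (I.mesh l) - I.zFinal l) + total (ζ (I.mesh l) (I.zFinal l)) (I.mesh l)) := by
  simp only [Lam, O.u_kmax hl, O.z_kmax hl]

/-- Linear convergence of the quasi-error product on a fixed level. -/
lemma Lam_le_pow (Hη : IsAdaptive P p refine 𝒯₀ η u uD Cstab qred Crel Cdrel)
    (Hζ : IsAdaptive P p refine 𝒯₀ ζ z zD Cstab qred Crel Cdrel)
    (hC : 0 < Cstab) (hq : 0 < qctr) (hq₁ : qctr < 1) (hlam : 0 < lam)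
    {l k : ℕ} (hl : (l : ℕ∞) ≤ I.last) (hk : (k : ℕ∞) ≤ I.kmax l) :
    I.Lam η ζ uD zD (l, k) ≤
      solverConst Cstab qctr lam ^ 2 * qctr ^ k * I.Lam η ζ uD zD (l, 0) := by
  have hm := O.isMeshSequence.mem hl
  obtain ⟨i, hi, hui, hik, -⟩ := (O.primal_solver l hl).exists_index k hk
  obtain ⟨j, hj, hzj, hjk, -⟩ := (O.dual_solver l hl).exists_index k hk
  have h1 := IsSolverRun.quasiError_le Hη hm (O.primal_solver l hl) hC hq hq₁ hlam i hi
  have h2 := IsSolverRun.quasiError_le Hζ hm (O.dual_solver l hl) hC hq hq₁ hlam j hj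
  have hc := one_le_solverConst hC hq hq₁ hlam
  -- As k does not exceed the maximum of the two stopping indices, at least one of i, j equals k.
  have hpow : qctr ^ i * qctr ^ j ≤ qctr ^ k := by
    rw [← pow_add]
    refine pow_le_pow_of_le_one hq.le hq₁.le ?_
    rcases le_max_iff.1 hk with h | h
    · rw [hik h]
      omega
    · rw [hjk h]
      omega
  have hLam := I.Lam_nonneg η ζ uD zD (l, 0)
  simp only [Lam] at hLam ⊢
  rw [hui, hzj]
  refine (mul_le_mul h1 h2 (add_nonneg (P.enorm_nonneg _) (total_nonneg _ _))
    (mul_nonneg (by positivity) (add_nonneg (P.enorm_nonneg _) (total_nonneg _ _)))).trans ?_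
  have := mul_le_mul_of_nonneg_right hpow
    (mul_nonneg (sq_nonneg (solverConst Cstab qctr lam)) hLam)
  linarith

/-- The quasi-error product of the initial iterates on a new level. -/
lemma Lam_succ_le (Hη : IsAdaptive P p refine 𝒯₀ η u uD Cstab qred Crel Cdrel)
    (Hζ : IsAdaptive P p refine 𝒯₀ ζ z zD Cstab qred Crel Cdrel)
    (hC : 0 < Cstab) (hCdrel : 0 < Cdrel) (hqred : 0 ≤ qred) (hqred₁ : qred < 1)
    {l : ℕ} (hl : (l : ℕ∞) < I.last) :
    I.Lam η ζ uD zD (l + 1, 0) ≤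
      (1 + Cdrel * (1 + Cstab)) ^ 2 * I.Lam η ζ uD zD (l, (I.kmax l).toNat) := by
  have hm := O.isMeshSequence.mem hl.le
  have hm' := O.isMeshSequence.succ_mem hl
  rw [O.Lam_kmax hl]
  simp only [Lam]
  rw [(O.nested l hl).1, (O.nested l hl).2]
  have h1 := Hη.quasiError_refinement_le hC.le hCdrel.le hqred hqred₁ hm hm' (O.uFinal_mem hl)
  have h2 := Hζ.quasiError_refinement_le hC.le hCdrel.le hqred hqred₁ hm hm' (O.zFinal_mem hl)
  refine (mul_le_mul h1 h2 (add_nonneg (P.enorm_nonneg _) (total_nonneg _ _))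
    (mul_nonneg (by positivity) (add_nonneg (P.enorm_nonneg _) (total_nonneg _ _)))).trans_eq ?_
  ring

/-- The run starts from the previous final iterate and makes at least one step, so at least one
factor `qctr` is gained. -/
lemma primal_solver_contraction (hq : 0 ≤ qctr) (hq₁ : qctr < 1) {l : ℕ}
    (hl : ((l + 1 : ℕ) : ℕ∞) < I.last) :
    P.enorm (uD (I.mesh (l + 1)) - I.uFinal (l + 1)) ≤
      qctr * P.enorm (uD (I.mesh (l + 1)) - I.uFinal l) := by
  have hl' : (l : ℕ∞) < I.last := lt_trans (by exact_mod_cast Nat.lt_succ_self l) hl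
  have S := O.primal_solver (l + 1) hl.le
  rw [← (O.nested l hl').1]
  refine (S.error_le hq _ (O.coe_m_toNat hl).le).trans
    (mul_le_mul_of_nonneg_right ?_ (P.enorm_nonneg _))
  have h1 := S.one_le
  rw [← O.coe_m_toNat hl] at h1
  exact pow_le_of_le_one hq hq₁.le (by have : 1 ≤ (I.m (l + 1)).toNat := by exact_mod_cast h1
                                       omega)

lemma dual_solver_contraction (hq : 0 ≤ qctr) (hq₁ : qctr < 1) {l : ℕ}
    (hl : ((l + 1 : ℕ) : ℕ∞) < I.last) :
    P.enorm (zD (I.mesh (l + 1)) - I.zFinal (l + 1)) ≤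
      qctr * P.enorm (zD (I.mesh (l + 1)) - I.zFinal l) := by
  have hl' : (l : ℕ∞) < I.last := lt_trans (by exact_mod_cast Nat.lt_succ_self l) hl
  have S := O.dual_solver (l + 1) hl.le
  rw [← (O.nested l hl').2]
  refine (S.error_le hq _ (O.coe_n_toNat hl).le).trans
    (mul_le_mul_of_nonneg_right ?_ (P.enorm_nonneg _))
  have h1 := S.one_le
  rw [← O.coe_n_toNat hl] at h1
  exact pow_le_of_le_one hq hq₁.le (by have : 1 ≤ (I.n (l + 1)).toNat := by exact_mod_cast h1
                                       omega)

/-- If both criteria failed, the failures weighted with the other (nonzero) squared estimator would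
add up to a violation of the marking criterion with 2θ. -/
lemma doerfler_primal_or_dual {l : ℕ} (hl : (l : ℕ∞) < I.last) :
    θ * total (η (I.mesh l) (I.uFinal l)) (I.mesh l) ^ 2 ≤
        total (η (I.mesh l) (I.uFinal l)) (I.marked l) ^ 2 ∨
      θ * total (ζ (I.mesh l) (I.zFinal l)) (I.mesh l) ^ 2 ≤
        total (ζ (I.mesh l) (I.zFinal l)) (I.marked l) ^ 2 := by
  obtain ⟨-, h1, h2⟩ := O.proceed l hl
  have h3 := (O.marking l hl).2
  by_contra! h
  have h4 := mul_lt_mul_of_pos_right h.1 (sq_pos_of_pos ((total_nonneg _ _).lt_of_ne' h2))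
  have h5 := mul_lt_mul_of_pos_right h.2 (sq_pos_of_pos ((total_nonneg _ _).lt_of_ne' h1))
  rw [MarkingCriterion] at h3
  linarith

end Iteration.IsOutput

/-- Linear convergence of the quasi-error product of the final iterates. -/
lemma exists_Lam_contraction {Cstab qred Crel qctr θ : ℝ} (hC : 0 < Cstab) (hCrel : 0 < Crel)
    (hqred : 0 ≤ qred) (hqred₁ : qred < 1) (hq : 0 < qctr) (hq₁ : qctr < 1) (hθ : 0 < θ)
    (hθ₁ : θ ≤ 1) :
    ∃ ρ C : ℝ, 0 < ρ ∧ ρ < 1 ∧ 0 < C ∧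
      ∀ {d : ℕ} {P : ModelProblem d} {I : Iteration P} {p : ℕ} {refine : Refinement d}
        {𝒯₀ : Mesh d} {η ζ : Indicators P} {u z : P.V} {uD zD : Mesh d → P.V} {Cdrel lam : ℝ},
        IsRefinementStrategy P.Ω refine 𝒯₀ →
        IsAdaptive P p refine 𝒯₀ η u uD Cstab qred Crel Cdrel →
        IsAdaptive P p refine 𝒯₀ ζ z zD Cstab qred Crel Cdrel →
        I.IsOutput p refine 𝒯₀ η ζ uD zD qctr θ lam →
        ∀ l n : ℕ, ((l + n : ℕ) : ℕ∞) < I.last →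
          I.Lam η ζ uD zD (l + n, (I.kmax (l + n)).toNat) ≤
            C * ρ ^ n * I.Lam η ζ uD zD (l, (I.kmax l).toNat) := by
  obtain ⟨ρ, C, hρ₀, hρ₁, hC₀, main⟩ := exists_product_contraction
    (κ := 1 - (1 - qred ^ 2) * θ) hC hCrel hq hq₁ (by nlinarith)
    (by have : 0 < (1 - qred ^ 2) * θ := mul_pos (by nlinarith) hθ
        linarith)
  refine ⟨ρ, C, hρ₀, hρ₁, hC₀, ?_⟩
  intro d P I p refine 𝒯₀ η ζ u z uD zD Cdrel lam hR Hη Hζ O l n hln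
  have hl : (l : ℕ∞) < I.last := lt_of_le_of_lt (by exact_mod_cast Nat.le_add_right l n) hln
  rw [O.Lam_kmax hl, O.Lam_kmax hln]
  exact main I.last _ _ _ _ _ _ _ _ _ _
    (Hη.isErrorSystem hR hC.le hCrel.le hqred hqred₁ O.isMeshSequence
      (fun _ h => O.uFinal_mem h) (fun _ h => O.primal_solver_contraction hq.le hq₁ h) hq.le)
    (Hζ.isErrorSystem hR hC.le hCrel.le hqred hqred₁ O.isMeshSequence
      (fun _ h => O.zFinal_mem h) (fun _ h => O.dual_solver_contraction hq.le hq₁ h) hq.le)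
    (fun _ h => O.doerfler_primal_or_dual h) l n hln

end GOAFEM
-- Bounds for the number of marked elements
namespace GOAFEM

section Marking

variable {d : ℕ} {𝒯 R ℳ : Mesh d} {η ζ : Simplex d → ℝ} {θ Cmark : ℝ}

lemma total_weighted_sq (𝒰 : Mesh d) : total (weighted 𝒯 η ζ) 𝒰 ^ 2 =
    total η 𝒰 ^ 2 * total ζ 𝒯 ^ 2 + total η 𝒯 ^ 2 * total ζ 𝒰 ^ 2 := by
  rw [total_sq _ 𝒰, total_sq η 𝒰, total_sq ζ 𝒰, Finset.sum_mul, Finset.mul_sum,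
    ← Finset.sum_add_distrib]
  refine Finset.sum_congr rfl fun T _ => ?_
  rw [weighted, Real.sq_sqrt (by positivity)]

/-- The squared weighted estimator of the whole mesh is 2η²ζ². A Dörfler criterion with 2ϑ² for only
one of the two estimators thus already yields one with ϑ² for the weighted estimator, and R competes
in the quasi-minimality. -/
lemma MarkingA.card_le (hM : MarkingA 𝒯 η ζ θ Cmark ℳ) (hR : R ⊆ 𝒯)
    (h : Doerfler 𝒯 η √(2 * θ) R ∨ Doerfler 𝒯 ζ √(2 * θ) R) :
    (ℳ.card : ℝ) ≤ Cmark * R.card := by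
  obtain ⟨ϑ, h0, -, rfl, -, -, hmin⟩ := hM
  refine hmin R hR ?_
  refine (abs_le_of_sq_le_sq' ?_ (total_nonneg _ _)).2
  rw [mul_pow, total_weighted_sq, total_weighted_sq]
  have hs : √(2 * ϑ ^ 2) ^ 2 = 2 * ϑ ^ 2 := Real.sq_sqrt (by positivity)
  have aux : ∀ μ : Simplex d → ℝ, Doerfler 𝒯 μ √(2 * ϑ ^ 2) R →
      2 * ϑ ^ 2 * total μ 𝒯 ^ 2 ≤ total μ R ^ 2 := by
    intro μ hμ
    rw [← hs, ← mul_pow]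
    exact pow_le_pow_left₀ (mul_nonneg (Real.sqrt_nonneg _) (total_nonneg _ _)) hμ 2
  rcases h with h | h
  · have h1 := mul_le_mul_of_nonneg_right (aux η h) (sq_nonneg (total ζ 𝒯))
    have h2 : 0 ≤ total η 𝒯 ^ 2 * total ζ R ^ 2 := by positivity
    linarith
  · have h1 := mul_le_mul_of_nonneg_right (aux ζ h) (sq_nonneg (total η 𝒯))
    have h2 : 0 ≤ total η R ^ 2 * total ζ 𝒯 ^ 2 := by positivity
    linarith

lemma sqrt_two_mul_half_sq {ϑ : ℝ} (h : 0 < ϑ) : √(2 * (ϑ ^ 2 / 2)) = ϑ := by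
  rw [mul_div_cancel₀ _ two_ne_zero, Real.sqrt_sq h.le]

/-- Whichever criterion R satisfies, it competes with one of the two sets, and the minimum is below
either cardinality. -/
lemma min_card_le {ϑ : ℝ} {ℳu ℳz : Mesh d} (hu : QuasiMinDoerfler 𝒯 η ϑ Cmark ℳu)
    (hz : QuasiMinDoerfler 𝒯 ζ ϑ Cmark ℳz) (hR : R ⊆ 𝒯)
    (h : Doerfler 𝒯 η ϑ R ∨ Doerfler 𝒯 ζ ϑ R) :
    ((min ℳu.card ℳz.card : ℕ) : ℝ) ≤ Cmark * R.card := by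
  rcases h with h | h
  · exact le_trans (by exact_mod_cast min_le_left _ _) (hu.2.2 R hR h)
  · exact le_trans (by exact_mod_cast min_le_right _ _) (hz.2.2 R hR h)

lemma MarkingB.card_le (hM : MarkingB 𝒯 η ζ θ Cmark ℳ) (hR : R ⊆ 𝒯)
    (h : Doerfler 𝒯 η √(2 * θ) R ∨ Doerfler 𝒯 ζ √(2 * θ) R) :
    (ℳ.card : ℝ) ≤ Cmark * R.card := by
  obtain ⟨ϑ, h0, -, rfl, ℳu, ℳz, hu, hz, hM⟩ := hM
  rw [sqrt_two_mul_half_sq h0] at h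
  have := min_card_le hu hz hR h
  rcases hM with ⟨rfl, hle⟩ | ⟨rfl, hle⟩
  · rwa [min_eq_left hle] at this
  · rwa [min_eq_right hle] at this

lemma MarkingC.card_le (hM : MarkingC 𝒯 η ζ θ Cmark ℳ) (hR : R ⊆ 𝒯)
    (h : Doerfler 𝒯 η √(2 * θ) R ∨ Doerfler 𝒯 ζ √(2 * θ) R) :
    (ℳ.card : ℝ) ≤ 2 * (Cmark * R.card) := by
  obtain ⟨ϑ, h0, -, rfl, ℳu, ℳz, hu, hz, ℳu', -, ℳz', -, cu, cz, rfl⟩ := hM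
  rw [sqrt_two_mul_half_sq h0] at h
  have h1 := min_card_le hu hz hR h
  have h2 : ((ℳu' ∪ ℳz').card : ℝ) ≤ ℳu'.card + ℳz'.card := by
    exact_mod_cast Finset.card_union_le _ _
  rw [cu, cz] at h2
  linarith

/-- All marking strategies select at most a multiple of the number of elements of any set that
satisfies one of the two Dörfler criteria. -/
lemma marked_card_le (hCmark : 0 ≤ Cmark)
    (hM : MarkingA 𝒯 η ζ θ Cmark ℳ ∨ MarkingB 𝒯 η ζ θ Cmark ℳ ∨ MarkingC 𝒯 η ζ θ Cmark ℳ)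
    (hR : R ⊆ 𝒯) (h : Doerfler 𝒯 η √(2 * θ) R ∨ Doerfler 𝒯 ζ √(2 * θ) R) :
    (ℳ.card : ℝ) ≤ 2 * (Cmark * R.card) := by
  have h0 : 0 ≤ Cmark * R.card := by positivity
  rcases hM with hM | hM | hM
  · linarith [hM.card_le hR h]
  · linarith [hM.card_le hR h]
  · exact hM.card_le hR h

end Marking

/-- Meshes that realize the approximation class up to an arbitrarily small excess. -/
lemma exists_mesh_of_approxNorm_lt {d : ℕ} {P : ModelProblem d} {refine : Refinement d}
    {𝒯₀ : Mesh d} {μ : Indicators P} {wD : Mesh d → P.V} {r A : ℝ} (hr : 0 < r)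
    (hA : approxNorm P refine 𝒯₀ μ wD r < ENNReal.ofReal A) (N : ℕ) :
    ∃ 𝒯 ∈ refinements refine 𝒯₀, 𝒯.card ≤ 𝒯₀.card + N ∧
      total (μ 𝒯 (wD 𝒯)) 𝒯 * ((N : ℝ) + 1) ^ r ≤ A := by
  by_contra! hcon
  refine absurd hA (not_lt.2 ?_)
  have hN : (0 : ℝ) < (N : ℝ) + 1 := by positivity
  have hpow : (0 : ℝ) < ((N : ℝ) + 1) ^ r := Real.rpow_pos_of_pos hN r
  have h1 : ENNReal.ofReal (A / ((N : ℝ) + 1) ^ r) ≤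
      ⨅ 𝒯 ∈ {𝒯 | 𝒯 ∈ refinements refine 𝒯₀ ∧ 𝒯.card ≤ 𝒯₀.card + N},
        ENNReal.ofReal (total (μ 𝒯 (wD 𝒯)) 𝒯) := by
    refine le_iInf₂ fun 𝒯 h𝒯 => ENNReal.ofReal_le_ofReal ?_
    rw [div_le_iff₀ hpow]
    exact (hcon 𝒯 h𝒯.1 h𝒯.2).le
  have h2 : ((N : ℝ≥0∞) + 1) ^ r = ENNReal.ofReal (((N : ℝ) + 1) ^ r) := by
    rw [← ENNReal.ofReal_rpow_of_nonneg hN.le hr.le, ENNReal.ofReal_add (by positivity) zero_le_one,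
      ENNReal.ofReal_natCast, ENNReal.ofReal_one]
  have h3 : ENNReal.ofReal A =
      ((N : ℝ≥0∞) + 1) ^ r * ENNReal.ofReal (A / ((N : ℝ) + 1) ^ r) := by
    rw [h2, ← ENNReal.ofReal_mul hpow.le, mul_div_cancel₀ _ hpow.ne']
  rw [h3]
  exact le_iSup_of_le N (mul_le_mul_right h1 _)

namespace IsAdaptive

variable {d : ℕ} {P : ModelProblem d} {p : ℕ} {refine : Refinement d} {𝒯₀ : Mesh d}
  {μ : Indicators P} {w : P.V} {wD : Mesh d → P.V} {Cstab qred Crel Cdrel : ℝ}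
  (H : IsAdaptive P p refine 𝒯₀ μ w wD Cstab qred Crel Cdrel)

include H

lemma total_le_total_discrete {𝒯 : Mesh d} (h : 𝒯 ∈ refinements refine 𝒯₀) {v : P.V}
    (hv : v ∈ P.X p 𝒯) {α : ℝ} (hα : Cstab * P.enorm (wD 𝒯 - v) ≤ α * total (μ 𝒯 v) 𝒯) :
    (1 - α) * total (μ 𝒯 v) 𝒯 ≤ total (μ 𝒯 (wD 𝒯)) 𝒯 := by
  have h1 := H.total_le_add_enorm h (H.mem 𝒯 h) hv (subset_refl _)
  rw [P.enorm_sub_comm] at h1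
  linarith

/-- Exchanging the exact discrete solution for v costs αμ(v) on R and the factor 1 - α on the whole
mesh. This is the origin of the quotient in the smallness condition on `θ` and `lam`. -/
lemma doerfler_perturb {𝒯 R : Mesh d} (h : 𝒯 ∈ refinements refine 𝒯₀) (hR : R ⊆ 𝒯) {v : P.V}
    (hv : v ∈ P.X p 𝒯) {α ϑ : ℝ} (hα : Cstab * P.enorm (wD 𝒯 - v) ≤ α * total (μ 𝒯 v) 𝒯)
    (hα₀ : 0 ≤ α) (hα₁ : α < 1) (hϑ : 0 ≤ ϑ)
    (hD : (ϑ + α) / (1 - α) * total (μ 𝒯 (wD 𝒯)) 𝒯 ≤ total (μ 𝒯 (wD 𝒯)) R) :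
    Doerfler 𝒯 (μ 𝒯 v) ϑ R := by
  have h1 := H.total_le_add_enorm h hv (H.mem 𝒯 h) hR
  have h2 := H.total_le_total_discrete h hv hα
  have h3 := mul_le_mul_of_nonneg_left h2
    (div_nonneg (add_nonneg hϑ hα₀) (sub_nonneg.2 hα₁.le))
  rw [← mul_assoc, div_mul_cancel₀ _ (sub_pos.2 hα₁).ne'] at h3
  rw [Doerfler]
  linarith

lemma quasiError_le_total_discrete {𝒯 : Mesh d} (h : 𝒯 ∈ refinements refine 𝒯₀) {v : P.V}
    (hv : v ∈ P.X p 𝒯) {α : ℝ} (hα : Cstab * P.enorm (wD 𝒯 - v) ≤ α * total (μ 𝒯 v) 𝒯)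
    (hα₀ : 0 ≤ α) (hα₁ : α < 1) (hC : 0 < Cstab) :
    P.enorm (wD 𝒯 - v) + total (μ 𝒯 v) 𝒯 ≤
      (1 + α / Cstab) / (1 - α) * total (μ 𝒯 (wD 𝒯)) 𝒯 := by
  have h1 := H.total_le_total_discrete h hv hα
  have h2 : P.enorm (wD 𝒯 - v) ≤ α / Cstab * total (μ 𝒯 v) 𝒯 := by
    rw [div_mul_eq_mul_div, le_div_iff₀ hC]
    linarith
  have h3 := mul_le_mul_of_nonneg_left h1
    (div_nonneg (by positivity : 0 ≤ 1 + α / Cstab) (sub_nonneg.2 hα₁.le))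
  rw [← mul_assoc, div_mul_cancel₀ _ (sub_pos.2 hα₁).ne'] at h3
  linarith

end IsAdaptive

/-- A refinement that reduces one of the two estimators by the factor `κ` and whose cost is
controlled by the product of the approximation constants. -/
lemma exists_reducing_refinement {d : ℕ} {P : ModelProblem d} {p : ℕ} {refine : Refinement d}
    {𝒯₀ : Mesh d} {η ζ : Indicators P} {u z : P.V} {uD zD : Mesh d → P.V}
    {Cstab qred Crel Cdrel κ s t A B : ℝ}
    (Hη : IsAdaptive P p refine 𝒯₀ η u uD Cstab qred Crel Cdrel)
    (Hζ : IsAdaptive P p refine 𝒯₀ ζ z zD Cstab qred Crel Cdrel)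
    (hsons : SonsProperty refine 𝒯₀) (hover : OverlayEstimate refine 𝒯₀)
    (hC : 0 < Cstab) (hCdrel : 0 < Cdrel) (hqred : 0 ≤ qred) (hqred₁ : qred < 1)
    (hκ : 0 < κ) (hs : 0 < s) (ht : 0 < t) (hA : 0 ≤ A) (hB : 0 ≤ B)
    (hA' : approxNorm P refine 𝒯₀ η uD s < ENNReal.ofReal A)
    (hB' : approxNorm P refine 𝒯₀ ζ zD t < ENNReal.ofReal B)
    {𝒯 : Mesh d} (h𝒯 : 𝒯 ∈ refinements refine 𝒯₀)
    (hη : 0 < total (η 𝒯 (uD 𝒯)) 𝒯) (hζ : 0 < total (ζ 𝒯 (zD 𝒯)) 𝒯) :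
    ∃ 𝒮 ∈ refinements refine 𝒯,
      ((𝒯 \ 𝒮).card : ℝ) ≤ 2 * (((1 + Cstab * Cdrel) / κ) ^ 2 * (A * B) /
        (total (η 𝒯 (uD 𝒯)) 𝒯 * total (ζ 𝒯 (zD 𝒯)) 𝒯)) ^ (1 / (s + t)) ∧
      (total (η 𝒮 (uD 𝒮)) 𝒮 ≤ κ * total (η 𝒯 (uD 𝒯)) 𝒯 ∨
        total (ζ 𝒮 (zD 𝒮)) 𝒮 ≤ κ * total (ζ 𝒯 (zD 𝒯)) 𝒯) := by
  have hr : 0 < s + t := by linarith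
  set a := total (η 𝒯 (uD 𝒯)) 𝒯
  set b := total (ζ 𝒯 (zD 𝒯)) 𝒯
  set c := 1 + Cstab * Cdrel with hc
  have hc₀ : 0 < c := by positivity
  set Y := (c / κ) ^ 2 * (A * B) / (a * b) with hY
  have hY₀ : 0 ≤ Y := by positivity
  -- The approximation norms weight with (N + 1)^r, so rounding down is harmless: Y < (N + 1)^(s +
  -- t) still holds strictly, while N itself is bounded by the power of Y.
  set N := ⌊Y ^ (1 / (s + t))⌋₊ with hN
  have hNle : (N : ℝ) ≤ Y ^ (1 / (s + t)) := Nat.floor_le (Real.rpow_nonneg hY₀ _)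
  have hNlt : Y < ((N : ℝ) + 1) ^ (s + t) := by
    have h1 := Real.rpow_lt_rpow (Real.rpow_nonneg hY₀ _)
      (Nat.lt_floor_add_one (Y ^ (1 / (s + t)))) hr
    rwa [← Real.rpow_mul hY₀, one_div_mul_cancel hr.ne', Real.rpow_one] at h1
  obtain ⟨𝒯₁, h₁, card₁, le₁⟩ := exists_mesh_of_approxNorm_lt hs hA' N
  obtain ⟨𝒯₂, h₂, card₂, le₂⟩ := exists_mesh_of_approxNorm_lt ht hB' N
  obtain ⟨𝒮₁, ⟨hS1, hS1'⟩, cardS₁⟩ := hover 𝒯 h𝒯 𝒯₁ h₁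
  obtain ⟨𝒮, ⟨hS, hS'⟩, cardS⟩ := hover 𝒮₁ (refinements_trans h𝒯 hS1) 𝒯₂ h₂
  have hS𝒯 := refinements_trans hS1 hS
  refine ⟨𝒮, hS𝒯, ?_, ?_⟩
  · have h3 := hsons 𝒯 h𝒯 𝒮 hS𝒯
    -- Each of the two overlays adds at most N elements, and by the sons property the refined
    -- elements are at most the added ones.
    have h4 : (𝒯 \ 𝒮).card ≤ 2 * N := by omega
    have h5 : ((𝒯 \ 𝒮).card : ℝ) ≤ 2 * N := by exact_mod_cast h4
    exact h5.trans (mul_le_mul_of_nonneg_left hNle zero_le_two)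
  -- If neither estimator drops by κ, quasi-monotonicity from both approximating meshes bounds κ²ab
  -- by c²a₁b₂, hence by c²AB/(N + 1)^(s + t), which is less than κ²ab by the choice of N.
  · by_contra! hcon
    obtain ⟨hcon1, hcon2⟩ := hcon
    have q1 := Hη.quasi_monotone hqred hqred₁ hC.le hCdrel.le h₁ (refinements_trans hS1' hS)
    have q2 := Hζ.quasi_monotone hqred hqred₁ hC.le hCdrel.le h₂ hS'
    rw [← hc] at q1 q2
    set a₁ := total (η 𝒯₁ (uD 𝒯₁)) 𝒯₁
    set b₂ := total (ζ 𝒯₂ (zD 𝒯₂)) 𝒯₂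
    have ha₁ : 0 ≤ a₁ := total_nonneg _ _
    have hb₂ : 0 ≤ b₂ := total_nonneg _ _
    have hN1 : (0 : ℝ) < (N : ℝ) + 1 := by positivity
    have m1 : κ * a * (κ * b) ≤ c * a₁ * (c * b₂) :=
      mul_le_mul (hcon1.le.trans q1) (hcon2.le.trans q2) (by positivity) (by positivity)
    have m2 : a₁ * ((N : ℝ) + 1) ^ s * (b₂ * ((N : ℝ) + 1) ^ t) ≤ A * B :=
      mul_le_mul le₁ le₂ (by positivity) hA
    have m3 : a₁ * b₂ * ((N : ℝ) + 1) ^ (s + t) ≤ A * B := by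
      rw [Real.rpow_add hN1]
      linarith
    have m4 : (c / κ) ^ 2 * (A * B) < ((N : ℝ) + 1) ^ (s + t) * (a * b) :=
      (div_lt_iff₀ (by positivity)).1 hNlt
    have m5 : a * b ≤ (c / κ) ^ 2 * (a₁ * b₂) := by
      rw [div_pow, div_mul_eq_mul_div, le_div_iff₀ (by positivity)]
      linarith
    have m6 := mul_le_mul_of_nonneg_left m5 (Real.rpow_nonneg hN1.le (s + t))
    have m7 := mul_le_mul_of_nonneg_left m3 (sq_nonneg (c / κ))
    linarith only [m4, m6, m7]

namespace Iteration.IsOutput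

variable {d : ℕ} {P : ModelProblem d} {I : Iteration P} {p : ℕ} {refine : Refinement d}
  {𝒯₀ : Mesh d} {η ζ : Indicators P} {u z : P.V} {uD zD : Mesh d → P.V}
  {Cstab qred Crel Cdrel qctr θ lam : ℝ}

lemma Lam_kmax_pos (O : I.IsOutput p refine 𝒯₀ η ζ uD zD qctr θ lam) {l : ℕ}
    (hl : (l : ℕ∞) < I.last) : 0 < I.Lam η ζ uD zD (l, (I.kmax l).toNat) := by
  rw [O.Lam_kmax hl]
  obtain ⟨-, h1, h2⟩ := O.proceed l hl
  exact mul_pos (add_pos_of_nonneg_of_pos (P.enorm_nonneg _) ((total_nonneg _ _).lt_of_ne' h1))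
    (add_pos_of_nonneg_of_pos (P.enorm_nonneg _) ((total_nonneg _ _).lt_of_ne' h2))

/-- Comparison lemma: the number of marked elements is controlled by the approximation constants
and the quasi-error product of the final iterates. -/
lemma marked_card_le_of_lt (O : I.IsOutput p refine 𝒯₀ η ζ uD zD qctr θ lam)
    (Hη : IsAdaptive P p refine 𝒯₀ η u uD Cstab qred Crel Cdrel)
    (Hζ : IsAdaptive P p refine 𝒯₀ ζ z zD Cstab qred Crel Cdrel)
    (hsons : SonsProperty refine 𝒯₀) (hover : OverlayEstimate refine 𝒯₀)
    (hC : 0 < Cstab) (hCdrel : 0 < Cdrel) (hqred : 0 ≤ qred) (hqred₁ : qred < 1)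
    (hq : 0 < qctr) (hq₁ : qctr < 1) (hlam : 0 < lam)
    {Cmark : ℝ} (hCmark : 1 ≤ Cmark) (hM : I.QuasiMinimalMarking η ζ θ Cmark)
    {α κ : ℝ} (hα : α = lam * (qctr * Cstab) / (1 - qctr)) (hα₁ : α < 1) (hκ : 0 < κ)
    (hτκ : ((√(2 * θ) + α) / (1 - α)) ^ 2 +
      (κ + Cstab * Cdrel * ((√(2 * θ) + α) / (1 - α))) ^ 2 ≤ 1)
    {s t A B : ℝ} (hs : 0 < s) (ht : 0 < t) (hA : 0 ≤ A) (hB : 0 ≤ B)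
    (hA' : approxNorm P refine 𝒯₀ η uD s < ENNReal.ofReal A)
    (hB' : approxNorm P refine 𝒯₀ ζ zD t < ENNReal.ofReal B)
    {l : ℕ} (hl : (l : ℕ∞) < I.last) :
    ((I.marked l).card : ℝ) ≤ 4 * Cmark *
      (((1 + Cstab * Cdrel) / κ) ^ 2 * ((1 + α / Cstab) / (1 - α)) ^ 2 * (A * B) /
        I.Lam η ζ uD zD (l, (I.kmax l).toNat)) ^ (1 / (s + t)) := by
  have hm := O.isMeshSequence.mem hl.le
  have hα₀ : 0 ≤ α := by
    rw [hα]
    exact div_nonneg (by positivity) (by linarith)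
  have h1α : 0 < 1 - α := by linarith
  -- Puts the stopping bound for the solver error in the form used for perturbations, with α =
  -- lam/λ⋆.
  have herr : ∀ e h : ℝ, (1 - qctr) * e ≤ qctr * lam * h → Cstab * e ≤ α * h := by
    intro e h hle
    rw [hα, div_mul_eq_mul_div, le_div_iff₀ (by linarith)]
    have := mul_le_mul_of_nonneg_left hle hC.le
    linarith
  have hu := herr _ _ ((O.primal_solver l hl.le).final_error_le hq.le (O.coe_m_toNat hl).symm)
  have hz := herr _ _ ((O.dual_solver l hl.le).final_error_le hq.le (O.coe_n_toNat hl).symm)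
  have humem := O.uFinal_mem hl
  have hzmem := O.zFinal_mem hl
  obtain ⟨-, hη, hζ⟩ := O.proceed l hl
  have hηpos := lt_of_lt_of_le (mul_pos h1α ((total_nonneg _ _).lt_of_ne' hη))
    (Hη.total_le_total_discrete hm humem hu)
  have hζpos := lt_of_lt_of_le (mul_pos h1α ((total_nonneg _ _).lt_of_ne' hζ))
    (Hζ.total_le_total_discrete hm hzmem hz)
  obtain ⟨𝒮, hS, hcard, hred⟩ := exists_reducing_refinement Hη Hζ hsons hover hC hCdrel hqred
    hqred₁ hκ hs ht hA hB hA' hB' hm hηpos hζpos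
  have hD : Doerfler (I.mesh l) (η (I.mesh l) (I.uFinal l)) √(2 * θ) (I.mesh l \ 𝒮) ∨
      Doerfler (I.mesh l) (ζ (I.mesh l) (I.zFinal l)) √(2 * θ) (I.mesh l \ 𝒮) := by
    refine hred.imp (fun h => ?_) fun h => ?_
    · exact Hη.doerfler_perturb hm Finset.sdiff_subset humem hu hα₀ hα₁ (Real.sqrt_nonneg _)
        (Hη.doerfler_of_total_le hC.le hCdrel.le hτκ hm hS h)
    · exact Hζ.doerfler_perturb hm Finset.sdiff_subset hzmem hz hα₀ hα₁ (Real.sqrt_nonneg _)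
        (Hζ.doerfler_of_total_le hC.le hCdrel.le hτκ hm hS h)
  have h1 := marked_card_le (by linarith) (hM l hl) Finset.sdiff_subset hD
  have h2 := mul_le_mul_of_nonneg_left hcard (by linarith : 0 ≤ Cmark)
  have h3 := h1.trans (mul_le_mul_of_nonneg_left h2 zero_le_two)
  -- One factor 2 stems from the union in the third marking strategy, the other from the two
  -- overlays.
  rw [show ∀ x : ℝ, 2 * (Cmark * (2 * x)) = 4 * Cmark * x from fun x => by ring] at h3
  refine h3.trans (mul_le_mul_of_nonneg_left
    (Real.rpow_le_rpow (by positivity) ?_ (by positivity)) (by linarith : 0 ≤ 4 * Cmark))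
  have hLpos := O.Lam_kmax_pos hl
  rw [div_le_div_iff₀ (by positivity) hLpos]
  have hLam : I.Lam η ζ uD zD (l, (I.kmax l).toNat) ≤ ((1 + α / Cstab) / (1 - α)) ^ 2 *
      (total (η (I.mesh l) (uD (I.mesh l))) (I.mesh l) *
        total (ζ (I.mesh l) (zD (I.mesh l))) (I.mesh l)) := by
    rw [O.Lam_kmax hl]
    refine (mul_le_mul (Hη.quasiError_le_total_discrete hm humem hu hα₀ hα₁ hC)
      (Hζ.quasiError_le_total_discrete hm hzmem hz hα₀ hα₁ hC)
      (add_nonneg (P.enorm_nonneg _) (total_nonneg _ _)) (by positivity)).trans_eq ?_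
    ring
  have := mul_le_mul_of_nonneg_left hLam
    (by positivity : 0 ≤ ((1 + Cstab * Cdrel) / κ) ^ 2 * (A * B))
  linarith only [this]

/-- Comparison lemma in terms of the approximation norms. -/
lemma marked_card_le_rpow (O : I.IsOutput p refine 𝒯₀ η ζ uD zD qctr θ lam)
    (Hη : IsAdaptive P p refine 𝒯₀ η u uD Cstab qred Crel Cdrel)
    (Hζ : IsAdaptive P p refine 𝒯₀ ζ z zD Cstab qred Crel Cdrel)
    (hsons : SonsProperty refine 𝒯₀) (hover : OverlayEstimate refine 𝒯₀)
    (hC : 0 < Cstab) (hCdrel : 0 < Cdrel) (hqred : 0 ≤ qred) (hqred₁ : qred < 1)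
    (hq : 0 < qctr) (hq₁ : qctr < 1) (hlam : 0 < lam)
    {Cmark : ℝ} (hCmark : 1 ≤ Cmark) (hM : I.QuasiMinimalMarking η ζ θ Cmark)
    {α κ : ℝ} (hα : α = lam * (qctr * Cstab) / (1 - qctr)) (hα₁ : α < 1) (hκ : 0 < κ)
    (hτκ : ((√(2 * θ) + α) / (1 - α)) ^ 2 +
      (κ + Cstab * Cdrel * ((√(2 * θ) + α) / (1 - α))) ^ 2 ≤ 1)
    {s t : ℝ} (hs : 0 < s) (ht : 0 < t)
    (hA : approxNorm P refine 𝒯₀ η uD s ≠ ⊤) (hB : approxNorm P refine 𝒯₀ ζ zD t ≠ ⊤)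
    {l : ℕ} (hl : (l : ℕ∞) < I.last) :
    ((I.marked l).card : ℝ) ≤ 4 * Cmark *
      (((1 + Cstab * Cdrel) / κ) ^ 2 * ((1 + α / Cstab) / (1 - α)) ^ 2 *
        ((approxNorm P refine 𝒯₀ η uD s).toReal * (approxNorm P refine 𝒯₀ ζ zD t).toReal) /
        I.Lam η ζ uD zD (l, (I.kmax l).toNat)) ^ (1 / (s + t)) := by
  set A := (approxNorm P refine 𝒯₀ η uD s).toReal with hAdef
  set B := (approxNorm P refine 𝒯₀ ζ zD t).toReal with hBdef
  have hA₀ : 0 ≤ A := ENNReal.toReal_nonneg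
  have hB₀ : 0 ≤ B := ENNReal.toReal_nonneg
  -- The preceding bound needs constants strictly above the norms. It is applied with A + ε and B +
  -- ε, and ε tends to 0; this also covers vanishing norms.
  have hcont : Continuous fun ε : ℝ => 4 * Cmark *
      (((1 + Cstab * Cdrel) / κ) ^ 2 * ((1 + α / Cstab) / (1 - α)) ^ 2 * ((A + ε) * (B + ε)) /
        I.Lam η ζ uD zD (l, (I.kmax l).toNat)) ^ (1 / (s + t)) := by
    refine continuous_const.mul (Continuous.rpow_const (by fun_prop) fun _ => Or.inr ?_)
    positivity
  have hlim := (hcont.tendsto 0).mono_left (nhdsWithin_le_nhds (s := Set.Ioi 0))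
  simp only [add_zero] at hlim
  refine ge_of_tendsto hlim ?_
  filter_upwards [self_mem_nhdsWithin] with ε hε
  have hε' : (0 : ℝ) < ε := hε
  refine O.marked_card_le_of_lt Hη Hζ hsons hover hC hCdrel hqred hqred₁ hq hq₁ hlam hCmark hM hα
    hα₁ hκ hτκ hs ht (by positivity) (by positivity) ?_ ?_ hl
  · exact (ENNReal.lt_ofReal_iff_toReal_lt hA).2 (by linarith)
  · exact (ENNReal.lt_ofReal_iff_toReal_lt hB).2 (by linarith)

end Iteration.IsOutput

end GOAFEM
-- Summation of the computational work
namespace GOAFEM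

lemma geom_sum_range_le {σ : ℝ} (h₀ : 0 ≤ σ) (h₁ : σ < 1) (n : ℕ) :
    ∑ i ∈ Finset.range n, σ ^ i ≤ 1 / (1 - σ) := by
  rw [one_div, ← tsum_geometric_of_lt_one h₀ h₁]
  exact (summable_geometric_of_lt_one h₀ h₁).sum_le_tsum _ fun i _ => pow_nonneg h₀ i

/-- Each of the first n terms of the geometric series is at least σⁿ. This absorbs the number of
solver steps on a level into their contraction. -/
lemma natCast_mul_pow_le {σ : ℝ} (h₀ : 0 ≤ σ) (h₁ : σ < 1) (n : ℕ) :
    (n : ℝ) * σ ^ n ≤ 1 / (1 - σ) := by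
  refine le_trans ?_ (geom_sum_range_le h₀ h₁ n)
  have h : ∑ _i ∈ Finset.range n, σ ^ n ≤ ∑ i ∈ Finset.range n, σ ^ i :=
    Finset.sum_le_sum fun i hi =>
      pow_le_pow_of_le_one h₀ h₁.le (Finset.mem_range.1 hi).le
  simpa using h

lemma sum_range_le_of_geometric {x : ℕ → ℝ} {c τ : ℝ} (hc : 0 ≤ c) (h₀ : 0 ≤ τ) (h₁ : τ < 1)
    {n : ℕ} (hx₀ : 0 ≤ x n) (hx : ∀ i m : ℕ, i + m = n → x i ≤ c * τ ^ m * x n) :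
    ∑ i ∈ Finset.range (n + 1), x i ≤ c * (1 / (1 - τ)) * x n := by
  have h : ∑ i ∈ Finset.range (n + 1), x i ≤
      ∑ i ∈ Finset.range (n + 1), c * x n * τ ^ (n + 1 - 1 - i) := by
    refine Finset.sum_le_sum fun i hi => (hx i (n - i) ?_).trans_eq ?_
    · have := Finset.mem_range.1 hi
      omega
    · rw [Nat.add_sub_cancel]
      ring
  rw [Finset.sum_range_reflect (fun i => c * x n * τ ^ i), ← Finset.mul_sum] at h
  have := mul_le_mul_of_nonneg_left (geom_sum_range_le h₀ h₁ (n + 1)) (mul_nonneg hc hx₀)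
  linarith

/-- Summation of the computational work: `x j`, `y j`, and `v` are the reciprocal quasi-errors of
the final iterate on level `j`, the initial iterate on level `j`, and the current iterate on level
`l`, respectively. -/
lemma exists_work_const {N₀ Ccls c₁ c₂ c₃ c₄ σ τ : ℝ} (hN₀ : 0 ≤ N₀) (hCcls : 0 ≤ Ccls)
    (hc₁ : 0 ≤ c₁) (hc₂ : 0 ≤ c₂) (hc₃ : 0 ≤ c₃) (hc₄ : 0 ≤ c₄) (hσ₀ : 0 ≤ σ) (hσ₁ : σ < 1)
    (hτ₀ : 0 ≤ τ) (hτ₁ : τ < 1) :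
    ∃ C : ℝ, 0 < C ∧ ∀ (l k : ℕ) (K : ℕ → ℕ) (x y M T : ℕ → ℝ) (v : ℝ),
      (∀ j, 0 ≤ x j) → (∀ j, 0 ≤ y j) → 0 ≤ v → 1 ≤ y 0 →
      (∀ j < l, y j ≤ c₁ * σ ^ K j * x j) → y l ≤ c₁ * σ ^ k * v →
      (∀ j < l, x j ≤ c₂ * y (j + 1)) →
      (∀ i n, i + n < l → x i ≤ c₃ * τ ^ n * x (i + n)) →
      (∀ j < l, M j ≤ c₄ * x j) →
      (∀ j ≤ l, T j ≤ N₀ + Ccls * ∑ i ∈ Finset.range j, M i) →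
      ∑ j ∈ Finset.range l, (K j : ℝ) * T j + k * T l ≤ C * v := by
  set S := c₃ * (1 / (1 - τ)) with hS
  have h1τ : 0 < 1 - τ := by linarith
  have h1σ : 0 < 1 - σ := by linarith
  have hS₀ : 0 ≤ S := by positivity
  -- The constant in T j ≤ D · y j: the first summand serves level 0, the product serves later
  -- levels through x i ≤ c₂ · y (i + 1).
  set D := N₀ + (N₀ * (c₁ * c₃) + Ccls * (c₄ * S)) * c₂ with hD
  have hD₀ : 0 ≤ D := by positivity
  set D' := D * (c₁ * (1 / (1 - σ))) with hD'
  have hD'₀ : 0 ≤ D' := by positivity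
  refine ⟨D' * (S * c₂ * c₁) + D' + 1, by positivity, ?_⟩
  intro l k K x y M T v hx hy hv hy0 hyx hyv hxy hgeo hM hT
  have hsum : ∀ n < l, ∑ i ∈ Finset.range (n + 1), x i ≤ S * x n := fun n hn =>
    sum_range_le_of_geometric hc₃ hτ₀ hτ₁ (hx n) fun i m him => by
      subst him
      exact hgeo i m hn
  have hTy : ∀ j ≤ l, T j ≤ D * y j := by
    intro j hj
    have h1 := hT j hj
    rcases j with _ | i
    · rw [Finset.sum_range_zero, mul_zero, add_zero] at h1
      have h2 : N₀ * 1 ≤ D * y 0 :=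
        mul_le_mul (le_add_of_nonneg_right (by positivity)) hy0 zero_le_one hD₀
      linarith
    · have hi : i < l := hj
      have h2 : ∑ i' ∈ Finset.range (i + 1), M i' ≤ c₄ * (S * x i) := by
        refine le_trans (Finset.sum_le_sum fun i' hi' => hM i' ?_) ?_
        · exact lt_of_lt_of_le (Finset.mem_range.1 hi') hj
        · rw [← Finset.mul_sum]
          exact mul_le_mul_of_nonneg_left (hsum i hi) hc₄
      -- The normalization 1 ≤ y 0 propagates along the growing reciprocals, so N₀ is bounded by a
      -- multiple of x i.
      have h3 : 1 ≤ c₁ * c₃ * x i := by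
        have h4 := hyx 0 (by omega)
        have h5 : c₁ * σ ^ K 0 * x 0 ≤ c₁ * x 0 := by
          have := mul_le_mul_of_nonneg_left (pow_le_one₀ hσ₀ hσ₁.le (n := K 0)) hc₁
          have := mul_le_mul_of_nonneg_right this (hx 0)
          linarith
        have h6 := hgeo 0 i (by omega)
        rw [zero_add] at h6
        have h7 : c₃ * τ ^ i * x i ≤ c₃ * x i := by
          have := mul_le_mul_of_nonneg_left (pow_le_one₀ hτ₀ hτ₁.le (n := i)) hc₃
          have := mul_le_mul_of_nonneg_right this (hx i)
          linarith
        have h8 := mul_le_mul_of_nonneg_left (h6.trans h7) hc₁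
        linarith
      have h4 := mul_le_mul_of_nonneg_left h2 hCcls
      have h5 := mul_le_mul_of_nonneg_left h3 hN₀
      have h6 := mul_le_mul_of_nonneg_left (hxy i hi)
        (by positivity : 0 ≤ N₀ * (c₁ * c₃) + Ccls * (c₄ * S))
      have h7 : 0 ≤ N₀ * y (i + 1) := mul_nonneg hN₀ (hy _)
      rw [hD]
      linarith
  -- A level costs n times its cardinality, but its n solver steps improve the reciprocal
  -- quasi-error by σⁿ, and nσⁿ is bounded.
  have hKT : ∀ (j n : ℕ) (a : ℝ), j ≤ l → 0 ≤ a → y j ≤ c₁ * σ ^ n * a →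
      (n : ℝ) * T j ≤ D' * a := by
    intro j n a hj ha h
    have h1 := mul_le_mul_of_nonneg_left (hTy j hj) (Nat.cast_nonneg n : (0 : ℝ) ≤ n)
    have h2 := mul_le_mul_of_nonneg_left h (by positivity : 0 ≤ (n : ℝ) * D)
    have h3 := mul_le_mul_of_nonneg_left (natCast_mul_pow_le hσ₀ hσ₁ n)
      (by positivity : 0 ≤ D * c₁ * a)
    rw [hD']
    linarith
  have hlast := hKT l k v le_rfl hv hyv
  have hlevels : ∑ j ∈ Finset.range l, (K j : ℝ) * T j ≤ D' * (S * c₂ * c₁) * v := by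
    have h1 : ∑ j ∈ Finset.range l, (K j : ℝ) * T j ≤ D' * ∑ j ∈ Finset.range l, x j := by
      rw [Finset.mul_sum]
      exact Finset.sum_le_sum fun j hj => hKT j (K j) (x j) (Finset.mem_range.1 hj).le (hx j)
        (hyx j (Finset.mem_range.1 hj))
    have h2 : ∑ j ∈ Finset.range l, x j ≤ S * c₂ * c₁ * v := by
      rcases l with _ | n
      · rw [Finset.sum_range_zero]
        positivity
      · have h3 := hsum n (Nat.lt_succ_self n)
        have h4 := mul_le_mul_of_nonneg_left (hxy n (Nat.lt_succ_self n)) hS₀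
        have h5 : y (n + 1) ≤ c₁ * v := by
          have := mul_le_mul_of_nonneg_left (pow_le_one₀ hσ₀ hσ₁.le (n := k)) hc₁
          have := mul_le_mul_of_nonneg_right this hv
          linarith
        have h6 := mul_le_mul_of_nonneg_left h5 (mul_nonneg hS₀ hc₂)
        linarith
    have := mul_le_mul_of_nonneg_left h2 hD'₀
    linarith
  linarith

namespace Iteration

variable {d : ℕ} {P : ModelProblem d} (I : Iteration P)

/-- The indices that precede `(l, k)` belong to lower levels, or to level `l` with smaller `k`. -/
lemma lt_or_of_steps_le {l k l' k' : ℕ} (hq : (l, k) ∈ I.Q) (hq' : (l', k') ∈ I.Q)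
    (hfin : ∀ j < l, I.kmax j ≠ ⊤) (h : I.steps (l', k') ≤ I.steps (l, k)) :
    l' < l ∨ (l' = l ∧ k' ≤ k) := by
  have hsum : ∑ j ∈ Finset.range l, I.kmax j ≠ ⊤ :=
    WithTop.sum_ne_top.2 fun j hj => hfin j (Finset.mem_range.1 hj)
  rcases lt_trichotomy l' l with hlt | rfl | hlt
  · exact Or.inl hlt
  · refine Or.inr ⟨rfl, ?_⟩
    have := (ENat.add_le_add_iff_right hsum).1 h
    exact_mod_cast this
  · exfalso
    have h1 : ∑ j ∈ Finset.range (l + 1), I.kmax j ≤ ∑ j ∈ Finset.range l', I.kmax j :=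
      Finset.sum_le_sum_of_subset (Finset.range_mono hlt)
    rw [Finset.sum_range_succ] at h1
    have h2 : (k : ℕ∞) ≤ I.kmax l := hq.2.2
    have h3 : (1 : ℕ∞) ≤ k' := by exact_mod_cast hq'.2.1
    -- An index on a higher level has all of level l behind it and k' ≥ 1, so its counter exceeds
    -- that of (l, k) by at least one. The latter counter is finite because the levels below l are,
    -- even if level l itself never stops.
    have h4 : (1 : ℕ∞) + ((k : ℕ∞) + ∑ j ∈ Finset.range l, I.kmax j) ≤
        (k : ℕ∞) + ∑ j ∈ Finset.range l, I.kmax j := by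
      refine le_trans (add_le_add h3 ?_) h
      rw [add_comm]
      exact (add_le_add_right h2 _).trans h1
    have hne : (k : ℕ∞) + ∑ j ∈ Finset.range l, I.kmax j ≠ ⊤ :=
      WithTop.add_ne_top.2 ⟨ENat.natCast_ne_top k, hsum⟩
    lift (k : ℕ∞) + ∑ j ∈ Finset.range l, I.kmax j to ℕ using hne with n
    have : 1 + n ≤ n := by exact_mod_cast h4
    omega

lemma work_le {l k : ℕ} (hq : (l, k) ∈ I.Q) (hfin : ∀ j < l, I.kmax j ≠ ⊤) :
    I.work (l, k) ≤ ENNReal.ofReal (∑ j ∈ Finset.range l,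
      ((I.kmax j).toNat : ℝ) * (I.mesh j).card + k * (I.mesh l).card) := by
  set t : ℕ → Finset ℕ := fun j =>
    if j < l then Finset.Icc 1 (I.kmax j).toNat else Finset.Icc 1 k with ht
  set F : Finset (ℕ × ℕ) := (Finset.range (l + 1) ×ˢ (Finset.range (l + 1)).biUnion t).filter
    fun q => q.2 ∈ t q.1 with hF
  have hmem : ∀ q : ℕ × ℕ, q ∈ F ↔ q.1 ∈ Finset.range (l + 1) ∧ q.2 ∈ t q.1 := by
    intro q
    simp only [hF, Finset.mem_filter, Finset.mem_product, Finset.mem_biUnion]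
    exact ⟨fun h => ⟨h.1.1, h.2⟩, fun h => ⟨⟨h.1, q.1, h⟩, h.2⟩⟩
  have hsub : {q | q ∈ I.Q ∧ I.steps q ≤ I.steps (l, k)} ⊆ (F : Set (ℕ × ℕ)) := by
    rintro ⟨l', k'⟩ ⟨hq', hsteps⟩
    rw [Finset.mem_coe, hmem]
    rcases I.lt_or_of_steps_le hq hq' hfin hsteps with h | ⟨rfl, h⟩
    · refine ⟨Finset.mem_range.2 (by omega), ?_⟩
      simp only [ht, if_pos h, Finset.mem_Icc]
      refine ⟨hq'.2.1, ?_⟩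
      have h1 : (k' : ℕ∞) ≤ I.kmax l' := hq'.2.2
      rw [← ENat.natCast_toNat (hfin l' h)] at h1
      exact_mod_cast h1
    · refine ⟨Finset.mem_range.2 (by omega), ?_⟩
      simp only [ht, lt_irrefl, if_false, Finset.mem_Icc]
      exact ⟨hq'.2.1, h⟩
  have h1 : I.work (l, k) ≤ ∑ q ∈ F, ((I.mesh q.1).card : ℝ≥0∞) := by
    rw [← Finset.tsum_subtype F (fun q => ((I.mesh q.1).card : ℝ≥0∞))]
    exact ENNReal.tsum_mono_subtype (fun q : ℕ × ℕ => ((I.mesh q.1).card : ℝ≥0∞)) hsub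
  refine h1.trans (le_of_eq ?_)
  rw [Finset.sum_finset_product F (Finset.range (l + 1)) t hmem, Finset.sum_range_succ]
  have h2 : ∀ j ∈ Finset.range l, ∑ _a ∈ t j, ((I.mesh j).card : ℝ≥0∞) =
      (((I.kmax j).toNat * (I.mesh j).card : ℕ) : ℝ≥0∞) := by
    intro j hj
    simp [ht, if_pos (Finset.mem_range.1 hj)]
  rw [Finset.sum_congr rfl h2]
  simp only [ht, lt_irrefl, if_false, Finset.sum_const, Nat.card_Icc, Nat.add_sub_cancel,
    nsmul_eq_mul]
  rw [← ENNReal.ofReal_natCast, ← ENNReal.ofReal_natCast]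
  norm_cast

end Iteration

/-- Turns decay of quasi-errors into growth of their reciprocal powers, the form required for the
work summation. -/
lemma div_rpow_le_of_le_mul {B a b c r : ℝ} (hB : 0 ≤ B) (hb : 0 < b) (hc : 0 < c) (hr : 0 < r)
    (h : b ≤ c * a) : (B / a) ^ (1 / r) ≤ c ^ (1 / r) * (B / b) ^ (1 / r) := by
  have ha : 0 < a := pos_of_mul_pos_right (hb.trans_le h) hc.le
  rw [← Real.mul_rpow hc.le (by positivity)]
  refine Real.rpow_le_rpow (by positivity) ?_ (by positivity)
  rw [← mul_div_assoc, div_le_div_iff₀ ha hb]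
  have := mul_le_mul_of_nonneg_left h hB
  linarith

lemma rpow_pow_comm {c ρ e : ℝ} (hc : 0 ≤ c) (hρ : 0 ≤ ρ) (n : ℕ) :
    (c * ρ ^ n) ^ e = c ^ e * (ρ ^ e) ^ n := by
  rw [Real.mul_rpow hc (by positivity), Real.rpow_pow_comm hρ]

end GOAFEM
namespace GOAFEM

/-- Optimal computational work for quasi-error products `f j` of the final iterate on level `j`,
`g j` of the initial iterate on level `j`, and `v` of the current iterate on level `l`. -/
lemma exists_optimality_const {N₀ Ccls c₁ c₂ c₃ c₄ Cm q ρ r : ℝ} (hN₀ : 0 ≤ N₀)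
    (hCcls : 0 ≤ Ccls) (hc₁ : 0 < c₁) (hc₂ : 0 < c₂) (hc₃ : 0 < c₃) (hc₄ : 0 ≤ c₄) (hCm : 0 ≤ Cm)
    (hq : 0 < q) (hq₁ : q < 1) (hρ : 0 < ρ) (hρ₁ : ρ < 1) (hr : 0 < r) :
    ∃ C : ℝ, 0 < C ∧ ∀ (l k : ℕ) (K : ℕ → ℕ) (f g M T : ℕ → ℝ) (v G : ℝ),
      (∀ j, 0 ≤ f j) → (∀ j, 0 ≤ g j) → (∀ j, 0 ≤ T j) → (∀ j < l, 0 < f j) → 0 < v →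
      g 0 ≤ G →
      (∀ j < l, f j ≤ c₁ * q ^ K j * g j) → v ≤ c₁ * q ^ k * g l →
      (∀ j < l, g (j + 1) ≤ c₂ * f j) →
      (∀ i n, i + n < l → f (i + n) ≤ c₃ * ρ ^ n * f i) →
      (∀ j < l, M j ≤ Cm * (c₄ * G / f j) ^ (1 / r)) →
      (∀ j ≤ l, T j ≤ N₀ + Ccls * ∑ i ∈ Finset.range j, M i) →
      (∑ j ∈ Finset.range l, (K j : ℝ) * T j + k * T l) ^ r * v ≤ C * G := by
  have he : 0 < 1 / r := by positivity
  obtain ⟨C, hC, hwork⟩ := exists_work_const (N₀ := N₀) (Ccls := Ccls)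
    (c₁ := c₁ ^ (1 / r)) (c₂ := c₂ ^ (1 / r)) (c₃ := c₃ ^ (1 / r)) (c₄ := Cm * c₄ ^ (1 / r))
    (σ := q ^ (1 / r)) (τ := ρ ^ (1 / r)) hN₀ hCcls (by positivity) (by positivity)
    (by positivity) (by positivity) (by positivity) (Real.rpow_lt_one hq.le hq₁ he)
    (by positivity) (Real.rpow_lt_one hρ.le hρ₁ he)
  refine ⟨C ^ r, by positivity, ?_⟩
  intro l k K f g M T v G hf hg hT hfpos hv hG hfg hvg hgf hgeo hM hTM
  have hG₀ : 0 ≤ G := (hg 0).trans hG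
  have hgpos : ∀ j ≤ l, 0 < g j := by
    intro j hj
    rcases hj.eq_or_lt with rfl | hj
    · exact pos_of_mul_pos_right (hv.trans_le hvg) (by positivity)
    · exact pos_of_mul_pos_right ((hfpos j hj).trans_le (hfg j hj)) (by positivity)
  -- Scaling the reciprocals by G makes the marking bound linear in x j, and g 0 ≤ G yields the
  -- normalization 1 ≤ y 0.
  have hbound := hwork l k K (fun j => (G / f j) ^ (1 / r)) (fun j => (G / g j) ^ (1 / r)) M T
    ((G / v) ^ (1 / r)) (fun j => Real.rpow_nonneg (div_nonneg hG₀ (hf j)) _)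
    (fun j => Real.rpow_nonneg (div_nonneg hG₀ (hg j)) _) (by positivity)
    (Real.one_le_rpow ((one_le_div (hgpos 0 (Nat.zero_le l))).2 hG) he.le)
    (fun j hj => by
      rw [← rpow_pow_comm hc₁.le hq.le]
      exact div_rpow_le_of_le_mul hG₀ (hfpos j hj) (by positivity) hr (hfg j hj))
    (by
      rw [← rpow_pow_comm hc₁.le hq.le]
      exact div_rpow_le_of_le_mul hG₀ hv (by positivity) hr hvg)
    (fun j hj => div_rpow_le_of_le_mul hG₀ (hgpos (j + 1) hj) hc₂ hr (hgf j hj))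
    (fun i n hin => by
      rw [← rpow_pow_comm hc₃.le hρ.le]
      exact div_rpow_le_of_le_mul hG₀ (hfpos (i + n) hin) (by positivity) hr (hgeo i n hin))
    (fun j hj => by
      rw [mul_assoc, ← Real.mul_rpow hc₄ (div_nonneg hG₀ (hf j)), ← mul_div_assoc]
      exact hM j hj)
    hTM
  have hW : 0 ≤ ∑ j ∈ Finset.range l, (K j : ℝ) * T j + k * T l :=
    add_nonneg (Finset.sum_nonneg fun j _ => mul_nonneg (Nat.cast_nonneg _) (hT j))
      (mul_nonneg (Nat.cast_nonneg _) (hT l))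
  have hGv : 0 ≤ G / v := by positivity
  have h1 := Real.rpow_le_rpow hW hbound hr.le
  rw [Real.mul_rpow hC.le (Real.rpow_nonneg hGv _), ← Real.rpow_mul hGv, one_div_mul_cancel hr.ne',
    Real.rpow_one] at h1
  have h2 := mul_le_mul_of_nonneg_right h1 hv.le
  rwa [mul_assoc, div_mul_cancel₀ _ hv.ne'] at h2

end GOAFEM


end

/-! ### Assembly of the main result -/

theorem theorem3p3
    (Ccls Cstab qred Crel Cdrel qctr Cmark θ lam s t : ℝ) (N₀ : ℕ)
    (hCcls : 0 < Ccls) (hCstab : 0 < Cstab) (hqred₀ : 0 < qred) (hqred₁ : qred < 1)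
    (hCrel : 0 < Crel) (hCdrel : 0 < Cdrel) (hqctr₀ : 0 < qctr) (hqctr₁ : qctr < 1)
    (hCmark : 1 ≤ Cmark) (hθ₀ : 0 < θ) (hθ₁ : θ ≤ 1) (hlam : 0 < lam)
    (hs : 0 < s) (ht : 0 < t)
    (θstar lamstar : ℝ)
    (hθstar : θstar = 1 / (1 + Cstab ^ 2 * Cdrel ^ 2))
    (hlamstar : lamstar = (1 - qctr) / (qctr * Cstab))
    (hlam_lt : lam < lamstar)
    (hsmall₀ : 0 < ((√(2 * θ) + lam / lamstar) / (1 - lam / lamstar)) ^ 2)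
    (hsmall₁ : ((√(2 * θ) + lam / lamstar) / (1 - lam / lamstar)) ^ 2 < θstar) :
    ∃ Copt : ℝ, 0 < Copt ∧
      ∀ (d : ℕ), 2 ≤ d → ∀ (P : GOAFEM.ModelProblem d) (p : ℕ), 1 ≤ p →
      ∀ (refine : GOAFEM.Refinement d) (𝒯₀ : GOAFEM.Mesh d),
        GOAFEM.IsRefinementStrategy P.Ω refine 𝒯₀ → 𝒯₀.card = N₀ →
        GOAFEM.SonsProperty refine 𝒯₀ →
        GOAFEM.ClosureEstimate refine 𝒯₀ Ccls →
        GOAFEM.OverlayEstimate refine 𝒯₀ →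
      ∀ (u z : P.V) (uD zD : GOAFEM.Mesh d → P.V),
        GOAFEM.IsPrimalSolution P u → GOAFEM.IsDualSolution P z →
        (∀ 𝒯 ∈ GOAFEM.refinements refine 𝒯₀,
          GOAFEM.IsDiscretePrimal P p 𝒯 (uD 𝒯) ∧ GOAFEM.IsDiscreteDual P p 𝒯 (zD 𝒯)) →
      ∀ (η ζ : GOAFEM.Indicators P),
        GOAFEM.NonnegIndicators P p refine 𝒯₀ η → GOAFEM.NonnegIndicators P p refine 𝒯₀ ζ →
        GOAFEM.Stability P p refine 𝒯₀ η ζ Cstab →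
        GOAFEM.Reduction P p refine 𝒯₀ η qred → GOAFEM.Reduction P p refine 𝒯₀ ζ qred →
        GOAFEM.Reliability P refine 𝒯₀ η u uD Crel →
        GOAFEM.Reliability P refine 𝒯₀ ζ z zD Crel →
        GOAFEM.DiscreteReliability P refine 𝒯₀ η uD Cdrel →
        GOAFEM.DiscreteReliability P refine 𝒯₀ ζ zD Cdrel →
      ∀ (I : GOAFEM.Iteration P),
        I.IsOutput p refine 𝒯₀ η ζ uD zD qctr θ lam →
        I.QuasiMinimalMarking η ζ θ Cmark →
        GOAFEM.approxNorm P refine 𝒯₀ η uD s + GOAFEM.approxNorm P refine 𝒯₀ ζ zD t < ⊤ →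
        ⨆ q ∈ I.Q, I.work q ^ (s + t) * ENNReal.ofReal (I.Lam η ζ uD zD q) ≤
          ENNReal.ofReal Copt *
            max (GOAFEM.approxNorm P refine 𝒯₀ η uD s * GOAFEM.approxNorm P refine 𝒯₀ ζ zD t)
              (ENNReal.ofReal (I.Lam η ζ uD zD (0, 0))) := by
  have hα : lam / lamstar = lam * (qctr * Cstab) / (1 - qctr) := by
    rw [hlamstar, div_div_eq_mul_div]
  have h1q : 0 < 1 - qctr := by linarith
  have hlamstar₀ : 0 < lamstar := hlam.trans hlam_lt
  have hα₁ : lam / lamstar < 1 := (div_lt_one hlamstar₀).2 hlam_lt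
  have hα₀ : 0 < lam / lamstar := by positivity
  have h1α : 0 < 1 - lam / lamstar := by linarith
  rw [hθstar] at hsmall₁
  -- All constants, from here to `Copt`, are fixed before the dimension, the problem and the run of
  -- the algorithm are introduced; this gives the asserted dependence.
  obtain ⟨κ, hκ, hτκ⟩ := GOAFEM.exists_reduction_factor hCstab hCdrel hsmall₁
  obtain ⟨ρ, C₃, hρ₀, hρ₁, hC₃, hcontr⟩ := GOAFEM.exists_Lam_contraction hCstab hCrel hqred₀.le
    hqred₁ hqctr₀ hqctr₁ hθ₀ hθ₁
  have hr : 0 < s + t := by linarith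
  have hsolver := GOAFEM.one_le_solverConst hCstab hqctr₀ hqctr₁ hlam
  have hCm : 0 ≤ 4 * Cmark := by linarith
  have hc₄ : 0 ≤ ((1 + Cstab * Cdrel) / κ) ^ 2 *
      ((1 + lam / lamstar / Cstab) / (1 - lam / lamstar)) ^ 2 := by positivity
  obtain ⟨Copt, hCopt, hopt⟩ := GOAFEM.exists_optimality_const (N₀ := (N₀ : ℝ)) (Ccls := Ccls)
    (c₁ := GOAFEM.solverConst Cstab qctr lam ^ 2) (c₂ := (1 + Cdrel * (1 + Cstab)) ^ 2) (c₃ := C₃)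
    (c₄ := ((1 + Cstab * Cdrel) / κ) ^ 2 *
      ((1 + lam / lamstar / Cstab) / (1 - lam / lamstar)) ^ 2)
    (Cm := 4 * Cmark) (Nat.cast_nonneg _) hCcls.le (by positivity) (by positivity) hC₃
    hc₄ hCm hqctr₀ hqctr₁ hρ₀ hρ₁ hr
  refine ⟨Copt, hCopt, ?_⟩
  intro d _ P p _ refine 𝒯₀ hR hN₀ hsons hcls hover u z uD zD hu hz hD η ζ _ _ hstab hredη hredζ
    hrelη hrelζ hdrelη hdrelζ I O hM hfin
  have Hη := GOAFEM.IsAdaptive.primal hR hu (fun 𝒯 h => (hD 𝒯 h).1) hstab hredη hrelη hdrelη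
  have Hζ := GOAFEM.IsAdaptive.dual hR hz (fun 𝒯 h => (hD 𝒯 h).2) hstab hredζ hrelζ hdrelζ
  obtain ⟨hA, hB⟩ := ENNReal.add_lt_top.1 hfin
  have hΛ₀ := I.Lam_nonneg η ζ uD zD
  have hmax : max (GOAFEM.approxNorm P refine 𝒯₀ η uD s * GOAFEM.approxNorm P refine 𝒯₀ ζ zD t)
      (ENNReal.ofReal (I.Lam η ζ uD zD (0, 0))) = ENNReal.ofReal
        (max ((GOAFEM.approxNorm P refine 𝒯₀ η uD s).toReal *
          (GOAFEM.approxNorm P refine 𝒯₀ ζ zD t).toReal) (I.Lam η ζ uD zD (0, 0))) := by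
    rw [ENNReal.ofReal_mono.map_max, ENNReal.ofReal_mul ENNReal.toReal_nonneg,
      ENNReal.ofReal_toReal hA.ne, ENNReal.ofReal_toReal hB.ne]
  rw [hmax, ← ENNReal.ofReal_mul hCopt.le]
  refine iSup₂_le ?_
  rintro ⟨l, k⟩ hq
  have hl : (l : ℕ∞) ≤ I.last := hq.1
  have hk : (k : ℕ∞) ≤ I.kmax l := hq.2.2
  rcases (hΛ₀ (l, k)).eq_or_lt with h0 | hpos
  -- A vanishing product is settled separately because the summation divides by it.
  · rw [← h0, ENNReal.ofReal_zero, mul_zero]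
    exact zero_le
  have hlt : ∀ j < l, (j : ℕ∞) < I.last := fun j hj =>
    lt_of_lt_of_le (by exact_mod_cast hj) hl
  have hwork := I.work_le hq fun j hj => (O.proceed j (hlt j hj)).1
  have hbound := hopt l k (fun j => (I.kmax j).toNat)
    (fun j => I.Lam η ζ uD zD (j, (I.kmax j).toNat)) (fun j => I.Lam η ζ uD zD (j, 0))
    (fun j => ((I.marked j).card : ℝ)) (fun j => ((I.mesh j).card : ℝ)) (I.Lam η ζ uD zD (l, k))
    (max ((GOAFEM.approxNorm P refine 𝒯₀ η uD s).toReal *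
      (GOAFEM.approxNorm P refine 𝒯₀ ζ zD t).toReal) (I.Lam η ζ uD zD (0, 0)))
    (fun j => hΛ₀ _) (fun j => hΛ₀ _) (fun j => Nat.cast_nonneg _)
    (fun j hj => O.Lam_kmax_pos (hlt j hj)) hpos (le_max_right _ _)
    (fun j hj => O.Lam_le_pow Hη Hζ hCstab hqctr₀ hqctr₁ hlam (hlt j hj).le
      (O.coe_kmax_toNat (hlt j hj)).le)
    (O.Lam_le_pow Hη Hζ hCstab hqctr₀ hqctr₁ hlam hl hk)
    (fun j hj => O.Lam_succ_le Hη Hζ hCstab hCdrel hqred₀.le hqred₁ (hlt j hj))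
    (fun i n hin => hcontr hR Hη Hζ O i n (hlt _ hin))
    -- The product of the norms is enlarged to the maximum, so that one number G serves both the
    -- marking bound and the initial level.
    (fun j hj => by
      refine (O.marked_card_le_rpow Hη Hζ hsons hover hCstab hCdrel hqred₀.le hqred₁ hqctr₀ hqctr₁
        hlam hCmark hM hα hα₁ hκ hτκ hs ht hA.ne hB.ne (hlt j hj)).trans ?_
      refine mul_le_mul_of_nonneg_left (Real.rpow_le_rpow ?_ ?_ (one_div_nonneg.2 hr.le)) hCm
      · exact div_nonneg (mul_nonneg hc₄
          (mul_nonneg ENNReal.toReal_nonneg ENNReal.toReal_nonneg)) (hΛ₀ _)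
      · exact div_le_div_of_nonneg_right
          (mul_le_mul_of_nonneg_left (le_max_left _ _) hc₄) (hΛ₀ _))
    (fun j hj => by
      rw [← hN₀]
      exact O.isMeshSequence.card_le hcls (le_trans (by exact_mod_cast hj) hl))
  refine le_trans (mul_le_mul_left (ENNReal.rpow_le_rpow hwork hr.le) _) ?_
  have hW : 0 ≤ ∑ j ∈ Finset.range l, ((I.kmax j).toNat : ℝ) * (I.mesh j).card +
      k * (I.mesh l).card :=
    add_nonneg (Finset.sum_nonneg fun _ _ => mul_nonneg (Nat.cast_nonneg _) (Nat.cast_nonneg _))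
      (mul_nonneg (Nat.cast_nonneg _) (Nat.cast_nonneg _))
  rw [ENNReal.ofReal_rpow_of_nonneg hW hr.le, ← ENNReal.ofReal_mul (Real.rpow_nonneg hW _)]
  exact ENNReal.ofReal_le_ofReal hbound
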